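/- Let $P$ be a partially ordered set, regarded as a topological space whose closed sets are the downward closed sets. A \emph{$P$-stratified space} is a space $T$ with a continuous map $T\to P$, and a \emph{$P$-stratified simplicial set} is a simplicial set $X$ with a map $X\to N(P)$ to the nerve; morphisms over $P$ are called stratum-preserving. The stratified realization $|X|_s$ is $|X|\to|N(P)|\to P$, where the second map sends a point $x$ of the simplex of a flag $[p_0\le\dots\le p_n]$ to $\sup\{p_i\mid x_i>0\}$. For $Q\subset P$ the coordinate $s_Q\colon|X|\to[0,1]$ is, on a simplex with flag $[p_0\le\dots\le p_n]$, the sum of the $x_i$ with $p_i\in Q$; write $s_p$, $s_{\not\le p}$, $s_{\not<p}$ for $Q=\{p\}$, $\{q\mid q\not\le p\}$, $\{q\mid q\not<p\}$. A \emph{strata-neighborhood system} on a stratified space $T$ is a family $U=(U(p))_{p\in P}$ of subsets of $T$ with $T_{\le p}\subset U(p)$ such that for every flag $\mathcal J$ of $P$ and every stratum-preserving map $\sigma\colon|\Delta^{\mathcal J}|_s\to T$ the set $\sigma^{-1}(U(p))$ is a neighborhood of $\sigma^{-1}(T_p)$. A stratum-preserving map $f\colon T\to T'$ is a map of strata-neighborhood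 systems $U\to U'$ if $f(U(p))\subset U'(p)$ for all $p$. For a family $\varphi=(\varphi_p)_{p\in P}$ of continuous functions $\varphi_p\colon[0,1]\to[0,1]$ with $\varphi_p(s)>0$ for $s>0$ (a \emph{control family}), the \emph{$\varphi$-standard system} on $|X|_s$ is $$N^{\varphi}_p(X)=\{x\in|X|\mid s_{\not\le p}\le\varphi_p(s_{\not<p})\,s_p\},$$ which is a strata-neighborhood system functorial in $X$; the \emph{standard system} $N(X)$ is the case $\varphi_p\equiv1$, that is $N_p(X)=\{s_{\not\le p}\le s_p\}$. Say that a natural stratum-preserving automorphism $\Phi$ of the functor $|-|_s$ is \emph{standardly homotopic to the identity} if there are natural stratum-preserving automorphisms $H_t$ ($t\in[0,1]$) of $|-|_s$ with $H_0=\mathrm{id}$ and $H_1=\Phi$ such that for every $X$ the map $|X|\times[0,1]\to|X|$, $(x,t)\mapsto H_{t,X}(x)$, is continuous and every $H_{t,X}$ is a map of strata-neighborhood systems $N(X)\to N(X)$. Then: 1. For every control family $\varphi$ there is a natural stratum-preserving automorphism $\Phi$ of $|-|_s$, standardly homotopic to the identity, such that for every $P$-stratified simplicial set $X$ the map $\Phi_X$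 is a map of strata-neighborhood systems $N(X)\to N^\varphi(X)$. In particular, $\Phi$ lifts to a natural transformation $N(-)\to N^{\varphi}(-)$ of functors to spaces with strata-neighborhood systems. 2. If $X$ is a finite $P$-stratified simplicial set and $U$ is a strata-neighborhood system on $|X|_s$, then there is a control family $\varphi$ with $N^\varphi_p(X)\subset U(p)$ for all $p\in P$; that is, the identity is a map of strata-neighborhood systems $N^\varphi(X)\to U$. 3. If $X$ is a finite $P$-stratified simplicial set, $U$ is a strata-neighborhood system on a $P$-stratified space $Y$, and $f\colon|X|_s\to Y$ is a stratum-preserving map, then there is a natural stratum-preserving automorphism $\Phi$ of $|-|_s$, standardly homotopic to the identity, such that $f\circ\Phi_X$ is a map of strata-neighborhood systems $N(X)\to U$. -/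

import Mathlib

open CategoryTheory Simplicial Opposite

universe u

namespace StratNbhd

/-! ### Maps out of the realization of a simplicial set -/

section Realization

/-- The point of `|X|` with barycentric coordinates `t` in the `n`-simplex `σ` of `X`. -/
noncomputable def simplexPoint {X : SSet.{u}} {n : SimplexCategory} (σ : X.obj (op n))
    (t : stdSimplex ℝ (Fin (n.len + 1))) : SSet.toTop.obj X :=
  (TopCat.toSSetObjEquiv _ _ ((sSetTopAdj.unit.app X).app (op n) σ)) t

/-- A family of continuous maps on the geometric simplices, indexed by the simplices of `X`
and compatible with all simplicial operators, glues to a continuous map on `|X|`. -/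
noncomputable def realizationDesc {X : SSet.{u}} {T : TopCat.{u}}
    (f : ∀ n : SimplexCategory, X.obj (op n) → C(stdSimplex ℝ (Fin (n.len + 1)), T))
    (hf : ∀ (m n : SimplexCategory) (g : m ⟶ n) (σ : X.obj (op n))
      (t : stdSimplex ℝ (Fin (m.len + 1))),
      f m (X.map g.op σ) t = f n σ (stdSimplex.map g t)) :
    SSet.toTop.obj X ⟶ T :=
  (sSetTopAdj.homEquiv X T).symm
    { app := fun n => TypeCat.ofHom fun σ => (TopCat.toSSetObjEquiv T n).symm (f n.unop σ)
      naturality := by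
        intro n m g
        ext σ
        apply (TopCat.toSSetObjEquiv T m).injective
        ext t
        exact hf m.unop n.unop g.unop σ t }

lemma hom_simplexPoint {X : SSet.{u}} {T : TopCat.{u}} (F : SSet.toTop.obj X ⟶ T)
    {n : SimplexCategory} (σ : X.obj (op n)) (t : stdSimplex ℝ (Fin (n.len + 1))) :
    F (simplexPoint σ t) =
      TopCat.toSSetObjEquiv T (op n) ((sSetTopAdj.homEquiv X T F).app (op n) σ) t := by
  rw [Adjunction.homEquiv_unit]
  rfl

lemma realizationDesc_simplexPoint {X : SSet.{u}} {T : TopCat.{u}}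
    (f : ∀ n : SimplexCategory, X.obj (op n) → C(stdSimplex ℝ (Fin (n.len + 1)), T))
    (hf) {n : SimplexCategory} (σ : X.obj (op n)) (t : stdSimplex ℝ (Fin (n.len + 1))) :
    realizationDesc f hf (simplexPoint σ t) = f n σ t := by
  rw [hom_simplexPoint, realizationDesc, Equiv.apply_symm_apply]
  rfl

lemma exists_simplexPoint {X : SSet.{u}} (x : SSet.toTop.obj X) :
    ∃ (n : SimplexCategory) (σ : X.obj (op n)) (t : stdSimplex ℝ (Fin (n.len + 1))),
      simplexPoint σ t = x := by
  let _ : TopologicalSpace (ULift.{u} Prop) := ⊤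
  let A : SSet.toTop.obj X → ULift.{u} Prop := fun x => ⟨∃ (n : SimplexCategory)
    (σ : X.obj (op n)) (t : stdSimplex ℝ (Fin (n.len + 1))), simplexPoint σ t = x⟩
  let F : SSet.toTop.obj X ⟶ TopCat.of (ULift.{u} Prop) :=
    TopCat.ofHom ⟨A, continuous_top⟩
  let G : SSet.toTop.obj X ⟶ TopCat.of (ULift.{u} Prop) :=
    TopCat.ofHom ⟨fun _ => ⟨True⟩, continuous_top⟩
  have h : F = G := by
    apply (sSetTopAdj.homEquiv _ _).injective
    ext n σ
    apply (TopCat.toSSetObjEquiv _ n).injective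
    ext t
    have h1 := hom_simplexPoint F (n := n.unop) σ t
    have h2 := hom_simplexPoint G (n := n.unop) σ t
    have h3 : A (simplexPoint (n := n.unop) σ t) = ⟨True⟩ :=
      congrArg ULift.up (eq_true ⟨n.unop, σ, t, rfl⟩)
    exact iff_of_eq (congrArg ULift.down (h1.symm.trans (h3.trans h2)))
  have h3 : A x = ⟨True⟩ := congrArg (fun K : SSet.toTop.obj X ⟶ TopCat.of (ULift.{u} Prop) =>
    K x) h
  exact of_eq_true (congrArg ULift.down h3)

lemma stdSimplex_map_apply {m n : ℕ} (g : Fin m → Fin n) (t : stdSimplex ℝ (Fin m)) (j : Fin n) :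
    stdSimplex.map g t j = ∑ i with g i = j, t i := by
  simp [FunOnFinite.linearMap_apply_apply]

end Realization

/-! ### Stratified simplicial sets, stratified spaces, stratified realization -/

/-- `P`-stratified simplicial sets: simplicial sets over the nerve of `P`. -/
abbrev StratSSet (P : Type u) [PartialOrder P] := Over (nerve P : SSet.{u})

/-- The poset `P` with the Alexandrov topology whose closed sets are the downward closed sets. -/
abbrev alexandrov (P : Type u) [PartialOrder P] : TopCat.{u} := TopCat.of (Topology.WithUpperSet P)

/-- `P`-stratified spaces: topological spaces over `P`. Morphisms are stratum-preserving maps. -/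
abbrev StratTop (P : Type u) [PartialOrder P] := Over (alexandrov P)

section

variable {P : Type u} [PartialOrder P]

/-- The stratum `T_p` of a stratified space. -/
def stratum (T : StratTop P) (p : P) : Set T.left :=
  {x | Topology.WithUpperSet.ofUpperSet (T.hom x) = p}

/-- The union `T_{≤ p}` of the strata of index at most `p`. -/
def strataLE (T : StratTop P) (p : P) : Set T.left :=
  {x | Topology.WithUpperSet.ofUpperSet (T.hom x) ≤ p}

lemma support_nonempty {n : ℕ} (t : stdSimplex ℝ (Fin n)) :
    (Finset.univ.filter fun i => 0 < t i).Nonempty := by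
  by_contra h
  rw [Finset.not_nonempty_iff_eq_empty, Finset.filter_eq_empty_iff] at h
  have h0 : ∀ i, t i = 0 := fun i => le_antisymm (not_lt.1 (h (Finset.mem_univ i))) (t.2.1 i)
  have h1 : ∑ i, t i = 1 := t.2.2
  simp [h0] at h1

/-- For a flag `[p_0 ≤ ⋯ ≤ p_n]` and a point `t` of the geometric `n`-simplex, the element
`sup {p_i | t_i > 0}` of `P`, that is `p_i` for the largest `i` with `t_i > 0`. -/
noncomputable def flagSup {n : SimplexCategory} (σ : (nerve P).obj (op n))
    (t : stdSimplex ℝ (Fin (n.len + 1))) : P :=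
  σ.obj ((Finset.univ.filter fun i => 0 < t i).max' (support_nonempty t))

lemma flagSup_isGreatest {n : SimplexCategory} (σ : (nerve P).obj (op n))
    (t : stdSimplex ℝ (Fin (n.len + 1))) :
    IsGreatest {q | ∃ i, 0 < t i ∧ σ.obj i = q} (flagSup σ t) := by
  constructor
  · have h := Finset.max'_mem _ (support_nonempty t)
    exact ⟨_, (Finset.mem_filter.1 h).2, rfl⟩
  · rintro q ⟨i, hi, rfl⟩
    exact leOfHom (σ.map (homOfLE (Finset.le_max' _ _
      (Finset.mem_filter.2 ⟨Finset.mem_univ i, hi⟩))))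

lemma flagSup_continuous {n : SimplexCategory} (σ : (nerve P).obj (op n)) :
    Continuous fun t : stdSimplex ℝ (Fin (n.len + 1)) =>
      Topology.WithUpperSet.toUpperSet (flagSup σ t) := by
  constructor
  intro U hU
  have hU' : IsUpperSet U := hU
  have : (fun t : stdSimplex ℝ (Fin (n.len + 1)) =>
      Topology.WithUpperSet.toUpperSet (flagSup σ t)) ⁻¹' U =
      ⋃ i, ⋃ (_ : Topology.WithUpperSet.toUpperSet (σ.obj i) ∈ U),
        (fun t : stdSimplex ℝ (Fin (n.len + 1)) => t i) ⁻¹' Set.Ioi 0 := by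
    ext t
    simp only [Set.mem_preimage, Set.mem_iUnion, Set.mem_Ioi, exists_prop]
    constructor
    · intro h
      obtain ⟨i, hi, hq⟩ := (flagSup_isGreatest σ t).1
      exact ⟨i, by rw [hq]; exact h, hi⟩
    · rintro ⟨i, hi, hpos⟩
      exact hU' (show Topology.WithUpperSet.toUpperSet (σ.obj i) ≤ _ from
        (flagSup_isGreatest σ t).2 ⟨i, hpos, rfl⟩) hi
  rw [this]
  refine isOpen_iUnion fun i => isOpen_iUnion fun _ => ?_
  exact isOpen_Ioi.preimage ((continuous_apply i).comp continuous_subtype_val)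

lemma stdSimplex_map_pos {m n : ℕ} (g : Fin m → Fin n) (t : stdSimplex ℝ (Fin m)) (j : Fin n) :
    0 < stdSimplex.map g t j ↔ ∃ i, g i = j ∧ 0 < t i := by
  rw [stdSimplex_map_apply]
  refine (Finset.sum_pos_iff_of_nonneg fun i _ => t.2.1 i).trans ?_
  simp only [Finset.mem_filter, Finset.mem_univ, true_and]
  rfl

variable (P) in
/-- The canonical map `|N P| → P`, which is `x ↦ sup {p_i | x_i > 0}` on the simplex
corresponding to the flag `[p_0 ≤ ⋯ ≤ p_n]`. -/
noncomputable def nerveStratification : SSet.toTop.obj (nerve P) ⟶ alexandrov P :=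
  realizationDesc (fun _ σ => ⟨_, flagSup_continuous σ⟩) (by
    intro m n g σ t
    change flagSup ((nerve P).map g.op σ) t = flagSup σ (stdSimplex.map g t)
    refine (flagSup_isGreatest _ _).unique ?_
    convert flagSup_isGreatest σ (stdSimplex.map g t) using 1
    ext q
    constructor
    · rintro ⟨i, hi, rfl⟩
      exact ⟨g i, (stdSimplex_map_pos _ _ _).2 ⟨i, rfl, hi⟩, rfl⟩
    · rintro ⟨j, hj, rfl⟩
      obtain ⟨i, rfl, hi⟩ := (stdSimplex_map_pos _ _ _).1 hj
      exact ⟨i, hi, rfl⟩)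

variable (P) in
/-- Stratified realization: `X → N P` is sent to `|X| → |N P| → P`. -/
noncomputable def sReal : StratSSet P ⥤ StratTop P :=
  Over.post SSet.toTop ⋙ Over.map (nerveStratification P)

/-- The stratified simplex associated to a flag `σ = [p_0 ≤ ⋯ ≤ p_n]` of `P`. -/
def flagSimplex {n : ℕ} (σ : (nerve P : SSet.{u}) _⦋n⦌) : StratSSet P :=
  Over.mk (SSet.yonedaEquiv.symm σ : Δ[n] ⟶ nerve P)

/-! ### Strata-neighborhood systems -/

/-- `U` is a `Δ_P`-neighborhood of `S` in `T`: for every stratum-preserving map `f` from a realized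
stratified simplex to `T`, the set `f⁻¹(U)` is a neighborhood of the set `f⁻¹(S)`. -/
def IsDeltaPNbhd (T : StratTop P) (S U : Set T.left) : Prop :=
  ∀ (n : ℕ) (σ : (nerve P : SSet.{u}) _⦋n⦌) (f : (sReal P).obj (flagSimplex σ) ⟶ T),
    f.left ⁻¹' U ∈ nhdsSet (f.left ⁻¹' S)

/-- A strata-neighborhood system of a stratified space `T`. -/
structure StrataNbhdSystem (T : StratTop P) where
  nbhd : P → Set T.left
  isDeltaPNbhd : ∀ p, IsDeltaPNbhd T (stratum T p) (nbhd p)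
  strataLE_subset : ∀ p, strataLE T p ⊆ nbhd p

/-- The stratum-preserving map `f` lifts to a map of strata-neighborhood systems `U → V`. -/
def LiftsToMap {T T' : StratTop P} (U : StrataNbhdSystem T) (V : StrataNbhdSystem T')
    (f : T ⟶ T') : Prop :=
  ∀ p, f.left '' U.nbhd p ⊆ V.nbhd p

variable (P) in
/-- Stratified spaces equipped with a strata-neighborhood system. -/
structure NbhdCat where
  space : StratTop P
  sys : StrataNbhdSystem space

/-- Morphisms are the stratum-preserving maps that lift to a map of neighborhood systems. -/
instance : Category (NbhdCat P) where
  Hom U V := {f : U.space ⟶ V.space // LiftsToMap U.sys V.sys f}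
  id U := ⟨𝟙 _, by rintro p _ ⟨x, hx, rfl⟩; exact hx⟩
  comp f g := ⟨f.1 ≫ g.1, by
    rintro p _ ⟨x, hx, rfl⟩
    exact g.2 p ⟨_, f.2 p ⟨x, hx, rfl⟩, rfl⟩⟩

variable (P) in
/-- The forgetful functor from neighborhood systems to stratified spaces. -/
def NbhdCat.forget : NbhdCat P ⥤ StratTop P where
  obj U := U.space
  map f := f.1

/-! ### The `s`-coordinates and standard neighborhoods -/

open Classical in
/-- For a flag `[p_0 ≤ ⋯ ≤ p_n]`, a set `Q ⊆ P` and a point `t` of the geometric simplex, the sum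
of those coordinates `t_i` with `p_i ∈ Q`. -/
noncomputable def flagCoord (Q : Set P) {n : SimplexCategory} (σ : (nerve P).obj (op n))
    (t : stdSimplex ℝ (Fin (n.len + 1))) : unitInterval :=
  ⟨∑ i with σ.obj i ∈ Q, t i, Finset.sum_nonneg fun i _ => t.2.1 i,
    (Finset.sum_le_univ_sum_of_nonneg fun i => t.2.1 i).trans_eq t.2.2⟩

/-- The coordinate `s_Q` on `|N P|`. -/
noncomputable def nerveCoord (Q : Set P) :
    SSet.toTop.obj (nerve P) ⟶ TopCat.of (ULift.{u} unitInterval) :=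
  realizationDesc (fun _ σ => ⟨fun t => ULift.up (flagCoord Q σ t), by
      refine continuous_uliftUp.comp (Continuous.subtype_mk ?_ _)
      exact continuous_finsetSum _ fun i _ =>
        (continuous_apply i).comp continuous_subtype_val⟩) (by
    classical
    intro m n g σ t
    change ULift.up _ = ULift.up _
    congr 1
    apply Subtype.ext
    change ∑ i with σ.obj (g i) ∈ Q, t i = ∑ j with σ.obj j ∈ Q, stdSimplex.map g t j
    simp_rw [stdSimplex_map_apply]
    rw [Finset.sum_filter, Finset.sum_filter]
    simp_rw [Finset.sum_filter]
    have : ∀ j, (if σ.obj j ∈ Q then ∑ i, (if g i = j then t i else 0) else 0) =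
        ∑ i, if g i = j then (if σ.obj (g i) ∈ Q then t i else 0) else 0 := by
      intro j
      split_ifs with h
      · refine Finset.sum_congr rfl fun i _ => ?_
        split_ifs with h1 h2 <;> simp_all
      · symm
        refine Finset.sum_eq_zero fun i _ => ?_
        split_ifs with h1 h2 <;> simp_all
    simp_rw [this]
    rw [Finset.sum_comm]
    simp)

/-- The coordinate `s_Q` on `|X|`, for `Q ⊆ P`: on a simplex of `X` with flag
`[p_0 ≤ ⋯ ≤ p_n]` it is the sum of the barycentric coordinates `x_i` with `p_i ∈ Q`. -/
noncomputable def sCoord (X : StratSSet P) (Q : Set P) (x : ((sReal P).obj X).left) :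
    unitInterval :=
  (nerveCoord Q (SSet.toTop.map X.hom x)).down

variable (P) in
/-- Families `φ = (φ_p)_{p ∈ P}` of continuous functions `φ_p : [0,1] → [0,1]` with `φ_p(s) > 0`
for all `s > 0`. -/
structure ControlFamily where
  toFun : P → C(unitInterval, unitInterval)
  pos : ∀ p s, 0 < s → 0 < toFun p s

variable (P) in
/-- The family of constant functions with value `1`. -/
def ControlFamily.one : ControlFamily P where
  toFun _ := ContinuousMap.const _ 1
  pos _ _ _ := one_pos

/-- The `φ_p`-standard neighborhood `{x ∈ |X| | s_{≰ p} ≤ φ_p(s_{≮ p}) s_p}`. -/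
def phiHood (φ : ControlFamily P) (X : StratSSet P) (p : P) : Set ((sReal P).obj X).left :=
  {x | (sCoord X {q | ¬ q ≤ p} x : ℝ) ≤
    φ.toFun p (sCoord X {q | ¬ q < p} x) * sCoord X {p} x}

lemma sCoord_continuous (X : StratSSet P) (Q : Set P) : Continuous (sCoord X Q) :=
  continuous_uliftDown.comp ((nerveCoord Q).hom.continuous.comp
    (SSet.toTop.map X.hom).hom.continuous)

lemma exists_coords (X : StratSSet P) (x : ((sReal P).obj X).left) :
    ∃ (n : SimplexCategory) (σ : (nerve P).obj (op n)) (t : stdSimplex ℝ (Fin (n.len + 1))),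
      ((sReal P).obj X).hom x = Topology.WithUpperSet.toUpperSet (flagSup σ t) ∧
      ∀ Q, sCoord X Q x = flagCoord Q σ t := by
  obtain ⟨n, σ, t, h⟩ := exists_simplexPoint (X := nerve P) (SSet.toTop.map X.hom x)
  refine ⟨n, σ, t, ?_, fun Q => ?_⟩
  · change nerveStratification P (SSet.toTop.map X.hom x) = _
    rw [← h]
    exact realizationDesc_simplexPoint _ _ σ t
  · unfold sCoord
    rw [← h, nerveCoord, realizationDesc_simplexPoint]
    rfl

lemma sCoord_notLE_eq_zero {X : StratSSet P} {x : ((sReal P).obj X).left} {p : P}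
    (hx : x ∈ strataLE ((sReal P).obj X) p) : (sCoord X {q | ¬ q ≤ p} x : ℝ) = 0 := by
  obtain ⟨n, σ, t, h1, h2⟩ := exists_coords X x
  have hp : flagSup σ t ≤ p := by
    have hx' : Topology.WithUpperSet.ofUpperSet (((sReal P).obj X).hom x) ≤ p := hx
    rw [h1] at hx'
    exact hx'
  obtain ⟨Q, hQ⟩ : ∃ Q : Set P, Q = {q | ¬ q ≤ p} := ⟨_, rfl⟩
  rw [← hQ, h2]
  classical
  change ∑ i with σ.obj i ∈ Q, t i = 0
  refine Finset.sum_eq_zero fun i hi => ?_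
  by_contra h
  have hpos : 0 < t i := lt_of_le_of_ne (t.2.1 i) (Ne.symm h)
  have hi2 := (Finset.mem_filter.1 hi).2
  rw [hQ] at hi2
  exact hi2 (((flagSup_isGreatest σ t).2 ⟨i, hpos, rfl⟩).trans hp)

lemma sCoord_pos {X : StratSSet P} {x : ((sReal P).obj X).left} {p : P} {Q : Set P} (hp : p ∈ Q)
    (hx : x ∈ stratum ((sReal P).obj X) p) : 0 < sCoord X Q x := by
  obtain ⟨n, σ, t, h1, h2⟩ := exists_coords X x
  have hxp : flagSup σ t = p := by
    have hx' : Topology.WithUpperSet.ofUpperSet (((sReal P).obj X).hom x) = p := hx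
    rw [h1] at hx'
    exact hx'
  rw [h2, ← Subtype.coe_lt_coe]
  obtain ⟨i, hi, hq⟩ := (flagSup_isGreatest σ t).1
  classical
  change 0 < ∑ i with σ.obj i ∈ Q, t i
  refine Finset.sum_pos' (fun i _ => t.2.1 i) ⟨i, ?_, hi⟩
  simp [hq, hxp, hp]

/-- The `φ`-standard neighborhood system on the realization of `X`. -/
def phiSystem (φ : ControlFamily P) (X : StratSSet P) : StrataNbhdSystem ((sReal P).obj X) where
  nbhd := phiHood φ X
  isDeltaPNbhd p n σ f := by
    let O : Set ((sReal P).obj X).left := {x | (sCoord X {q | ¬ q ≤ p} x : ℝ) <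
      φ.toFun p (sCoord X {q | ¬ q < p} x) * sCoord X {p} x}
    have hO : IsOpen O := isOpen_lt
      (continuous_subtype_val.comp (sCoord_continuous _ _))
      ((continuous_subtype_val.comp ((φ.toFun p).continuous.comp (sCoord_continuous _ _))).mul
        (continuous_subtype_val.comp (sCoord_continuous _ _)))
    rw [mem_nhdsSet_iff_exists]
    refine ⟨f.left ⁻¹' O, hO.preimage f.left.hom.continuous, ?_,
      Set.preimage_mono fun x (hx : (_ : ℝ) < _) => hx.le⟩
    refine Set.preimage_mono fun x hx => ?_
    have h0 : (sCoord X {q | ¬ q ≤ p} x : ℝ) = 0 := sCoord_notLE_eq_zero (le_of_eq hx)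
    change (sCoord X {q | ¬ q ≤ p} x : ℝ) < _
    rw [h0]
    exact mul_pos (φ.pos p _ (sCoord_pos (lt_irrefl p) hx)) (sCoord_pos (Set.mem_singleton p) hx)
  strataLE_subset p x hx := by
    change (sCoord X {q | ¬ q ≤ p} x : ℝ) ≤ _
    rw [sCoord_notLE_eq_zero hx]
    exact mul_nonneg (φ.toFun p _).2.1 (sCoord X {p} x).2.1

lemma sCoord_map {X Y : StratSSet P} (f : X ⟶ Y) (Q : Set P) (x : ((sReal P).obj X).left) :
    sCoord Y Q (((sReal P).map f).left x) = sCoord X Q x := by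
  have h : SSet.toTop.map Y.hom (SSet.toTop.map f.left x) = SSet.toTop.map X.hom x := by
    rw [← Over.w f, Functor.map_comp]
    rfl
  exact congrArg (fun y => (nerveCoord Q y).down) h

/-- The `φ`-standard neighborhood systems as a functor on stratified simplicial sets, which
lifts stratified realization. -/
noncomputable def phiSystemFunctor (φ : ControlFamily P) : StratSSet P ⥤ NbhdCat P where
  obj X := ⟨(sReal P).obj X, phiSystem φ X⟩
  map f := ⟨(sReal P).map f, by
    rintro p _ ⟨x, hx, rfl⟩
    have hx' : (sCoord _ {q | ¬ q ≤ p} x : ℝ) ≤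
      φ.toFun p (sCoord _ {q | ¬ q < p} x) * sCoord _ {p} x := hx
    change (sCoord _ {q | ¬ q ≤ p} _ : ℝ) ≤
      φ.toFun p (sCoord _ {q | ¬ q < p} _) * sCoord _ {p} _
    simpa only [sCoord_map] using hx'⟩
  map_id X := Subtype.ext ((sReal P).map_id X)
  map_comp f g := Subtype.ext ((sReal P).map_comp f g)

/-- The standard neighborhood system `{s_{≰ p} ≤ s_p}` on the realization of `X`. -/
abbrev stdSystem (X : StratSSet P) : StrataNbhdSystem ((sReal P).obj X) :=
  phiSystem (ControlFamily.one P) X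

/-- The natural automorphism `Φ` of stratified realization is naturally stratum-preserving
homotopic to the identity, through natural stratum-preserving automorphisms that lift to maps from
the standard neighborhood system to itself. -/
def StdHomotopicToId (Φ : sReal P ≅ sReal P) : Prop :=
  ∃ H : unitInterval → (sReal P ≅ sReal P),
    H 0 = Iso.refl _ ∧ H 1 = Φ ∧
    (∀ X : StratSSet P, Continuous fun z : ((sReal P).obj X).left × unitInterval =>
      ((H z.2).hom.app X).left z.1) ∧
    ∀ (t : unitInterval) (X : StratSSet P),
      LiftsToMap (stdSystem X) (stdSystem X) ((H t).hom.app X)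

end

end StratNbhd

/-! On a stratified simplex and for `p` in its flag, fix the coordinates in strata below `p`, keep
the total `s_{≮p} = s_p + s_{≰p}`, and redistribute it so that the ratio `s_{≰p} : s_p` is
multiplied by `φ_p(s_{≮p})`. This `rescale` turns `s_{≰p} ≤ s_p` into `s_{≰p} ≤ φ_p(s_{≮p}) s_p`. It
preserves supports, hence strata, and its inverse divides the ratio instead, because `s_{≮p}` does
not change.

Compose the rescalings over all elements of the flag in increasing order (`flagFlow`). Those at
elements below `p` scale `s_p` and `s_{≰p}` by a common factor and so keep `s_{≰p} ≤ s_p`; the one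
at `p` produces the `φ`-inequality; those above `p` leave all the coordinates involved unchanged
(`flagFlow_mem`). A rescaling at an element outside the flag is the identity, so the composite
commutes with simplicial operators (`map_flagFlow`) and glues to an automorphism of `|-|_s`.
Replacing `φ` by `(1 - r) + r φ ≤ 1` gives the standard homotopy.

For subordination, consider the points of the nondegenerate simplices lying outside open sets that
map into `U(p)` and contain the preimage of the `p`-stratum. For finite `X`, their image under
`(s_{≮p}, s_{≰p})` is a compact subset of the plane missing the positive half-axis. Half the
distance to it serves as `φ_p` (`exists_control_of_isCompact`, `exists_phiHood_subset`). The last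
claim combines both constructions after pulling `U` back along `f`. -/

namespace StratNbhd

variable {P : Type u}

/-! ### Interpolation of control families -/

section Interpolation

/-- The control family `(1 - r) + r φ`. -/
noncomputable def ControlFamily.interp (φ : ControlFamily P) (r : unitInterval) :
    ControlFamily P where
  toFun p := ⟨fun s => ⟨(1 - r) + r * φ.toFun p s,
    add_nonneg (sub_nonneg.2 r.2.2) (mul_nonneg r.2.1 (φ.toFun p s).2.1), by
      have := mul_le_mul_of_nonneg_left (φ.toFun p s).2.2 r.2.1
      linarith⟩, by
    refine Continuous.subtype_mk (continuous_const.add (continuous_const.mul ?_)) _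
    exact continuous_subtype_val.comp (φ.toFun p).continuous⟩
  pos p s hs := by
    have h : (0 : ℝ) < φ.toFun p s := φ.pos p s hs
    change (0 : ℝ) < (1 - r) + r * φ.toFun p s
    rcases r.2.2.eq_or_lt with hr | hr
    · rw [hr]
      linarith
    · have := mul_nonneg r.2.1 h.le
      linarith

lemma ControlFamily.interp_zero (φ : ControlFamily P) : φ.interp 0 = .one P := by
  unfold interp one
  congr 1
  funext p
  ext s
  change (1 - ((0 : unitInterval) : ℝ)) + (0 : unitInterval) * (φ.toFun p s : ℝ) = 1
  simp

lemma ControlFamily.interp_one (φ : ControlFamily P) : φ.interp 1 = φ := by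
  obtain ⟨f, hf⟩ := φ
  unfold interp
  congr 1
  funext p
  ext s
  change (1 - ((1 : unitInterval) : ℝ)) + (1 : unitInterval) * (f p s : ℝ) = f p s
  simp

lemma ControlFamily.continuous_interp (φ : ControlFamily P) (p : P) :
    Continuous fun z : unitInterval × unitInterval => (φ.interp z.1).toFun p z.2 := by
  refine Continuous.subtype_mk ?_ _
  have h1 : Continuous fun z : unitInterval × unitInterval => (z.1 : ℝ) :=
    continuous_subtype_val.comp continuous_fst
  have h2 : Continuous fun z : unitInterval × unitInterval => (φ.toFun p z.2 : ℝ) :=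
    continuous_subtype_val.comp ((φ.toFun p).continuous.comp continuous_snd)
  exact (continuous_const.sub h1).add (h1.mul h2)

end Interpolation

variable [PartialOrder P]

/-! ### Coordinates on a stratified simplex -/

section Coordinates

variable {n : SimplexCategory} (σ : (nerve P).obj (op n))
  (t : stdSimplex ℝ (Fin (n.len + 1)))

lemma flagCoord_eq_sum (Q : Set P) :
    (flagCoord Q σ t : ℝ) = ∑ i, t i * Q.indicator 1 (σ.obj i) := by
  classical
  change ∑ i with σ.obj i ∈ Q, t i = _
  rw [Finset.sum_filter]
  refine Finset.sum_congr rfl fun i _ => ?_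
  by_cases h : σ.obj i ∈ Q
  · rw [if_pos h, Set.indicator_of_mem h, Pi.one_apply, mul_one]
  · rw [if_neg h, Set.indicator_of_notMem h, mul_zero]

lemma sum_stdSimplex_map_mul {k l : ℕ} (g : Fin k → Fin l) (t : stdSimplex ℝ (Fin k))
    (F : Fin l → ℝ) : ∑ j, stdSimplex.map g t j * F j = ∑ i, t i * F (g i) := by
  simp_rw [stdSimplex_map_apply, Finset.sum_mul]
  rw [← Finset.sum_fiberwise _ g]
  refine Finset.sum_congr rfl fun j _ => Finset.sum_congr rfl fun i hi => ?_
  rw [(Finset.mem_filter.1 hi).2]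

lemma flagCoord_map {m : SimplexCategory} (g : m ⟶ n) (Q : Set P)
    (t : stdSimplex ℝ (Fin (m.len + 1))) :
    flagCoord Q ((nerve P).map g.op σ) t = flagCoord Q σ (stdSimplex.map g t) := by
  apply Subtype.ext
  rw [flagCoord_eq_sum, flagCoord_eq_sum]
  exact (sum_stdSimplex_map_mul g t fun j => Q.indicator 1 (σ.obj j)).symm

lemma flagCoord_union {Q R : Set P} (h : Disjoint Q R) :
    (flagCoord (Q ∪ R) σ t : ℝ) = flagCoord Q σ t + flagCoord R σ t := by
  simp_rw [flagCoord_eq_sum, Set.indicator_union_of_disjoint h, mul_add,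
    Finset.sum_add_distrib]

lemma flagCoord_univ : (flagCoord Set.univ σ t : ℝ) = 1 := by
  simp_rw [flagCoord_eq_sum, Set.indicator_univ, Pi.one_apply, mul_one]
  exact t.2.2

lemma setOf_not_lt_eq (p : P) : {q | ¬ q < p} = {p} ∪ {q | ¬ q ≤ p} := by
  ext q
  simp only [Set.mem_ofPred_eq, Set.mem_union, Set.mem_singleton_iff, lt_iff_le_and_ne]
  by_cases h : q = p <;> simp [h]

lemma disjoint_setOf_not_le (p : P) : Disjoint {p} {q | ¬ q ≤ p} := by simp

lemma disjoint_setOf_lt (p : P) : Disjoint {q | q < p} {q | ¬ q < p} :=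
  Set.disjoint_left.2 fun _ h h' => Set.mem_ofPred.1 h' h

lemma flagCoord_not_lt (p : P) : (flagCoord {q | ¬ q < p} σ t : ℝ) =
    flagCoord {p} σ t + flagCoord {q | ¬ q ≤ p} σ t := by
  rw [← flagCoord_union _ _ (disjoint_setOf_not_le p), setOf_not_lt_eq]

lemma le_flagCoord {Q : Set P} {i : Fin (n.len + 1)} (h : σ.obj i ∈ Q) :
    t i ≤ flagCoord Q σ t := by
  rw [flagCoord_eq_sum]
  refine le_trans (le_of_eq ?_) (Finset.single_le_sum
    (f := fun i => t i * Q.indicator 1 (σ.obj i)) (fun j _ => ?_) (Finset.mem_univ i))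
  · dsimp only
    rw [Set.indicator_of_mem h, Pi.one_apply, mul_one]
  · exact mul_nonneg (t.2.1 j) (Set.indicator_nonneg (fun _ _ => zero_le_one) _)

lemma flagCoord_eq_zero_iff {Q : Set P} :
    (flagCoord Q σ t : ℝ) = 0 ↔ ∀ i, σ.obj i ∈ Q → t i = 0 := by
  constructor
  · intro h i hi
    exact le_antisymm ((le_flagCoord σ t hi).trans_eq h) (t.2.1 i)
  · intro h
    rw [flagCoord_eq_sum]
    refine Finset.sum_eq_zero fun i _ => ?_
    by_cases hi : σ.obj i ∈ Q
    · rw [h i hi, zero_mul]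
    · rw [Set.indicator_of_notMem hi, mul_zero]

lemma continuous_flagCoord (Q : Set P) : Continuous (flagCoord Q σ) :=
  Continuous.subtype_mk (continuous_finsetSum _ fun i _ =>
    (continuous_apply i).comp continuous_subtype_val) _

/-- The stratum of a point depends only on its support; this is why every self-map built below is
stratum-preserving. -/
lemma flagSup_congr {t t' : stdSimplex ℝ (Fin (n.len + 1))} (h : ∀ i, 0 < t i ↔ 0 < t' i) :
    flagSup σ t = flagSup σ t' := by
  refine (flagSup_isGreatest σ t).unique ?_
  simp_rw [h]
  exact flagSup_isGreatest σ t'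

lemma flagSup_le_of_flagCoord_eq_zero {p : P}
    (h : (flagCoord {q | ¬ q ≤ p} σ t : ℝ) = 0) : flagSup σ t ≤ p := by
  obtain ⟨i, hi, hq⟩ := (flagSup_isGreatest σ t).1
  by_contra hlt
  exact hi.ne' ((flagCoord_eq_zero_iff σ t).1 h i (by rwa [hq]))

lemma flagSup_eq_of_flagCoord {p : P} (h : (flagCoord {q | ¬ q ≤ p} σ t : ℝ) = 0)
    (hp : 0 < (flagCoord {p} σ t : ℝ)) : flagSup σ t = p := by
  refine le_antisymm (flagSup_le_of_flagCoord_eq_zero σ t h) ?_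
  by_contra hlt
  refine hp.ne' ((flagCoord_eq_zero_iff σ t).2 fun i hi => ?_)
  rw [Set.mem_singleton_iff] at hi
  by_contra h0
  exact hlt (hi ▸ (flagSup_isGreatest σ t).2 ⟨i, lt_of_le_of_ne (t.2.1 i) (Ne.symm h0), rfl⟩)

lemma flagCoord_eq_zero_congr {t t' : stdSimplex ℝ (Fin (n.len + 1))}
    (h : ∀ i, 0 < t i ↔ 0 < t' i) {Q : Set P} :
    (flagCoord Q σ t : ℝ) = 0 ↔ (flagCoord Q σ t' : ℝ) = 0 := by
  have h' (i) : t i = 0 ↔ t' i = 0 := by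
    have := h i
    have h1 : 0 ≤ t i := t.2.1 i
    have h2 : 0 ≤ t' i := t'.2.1 i
    rw [le_antisymm_iff, le_antisymm_iff, ← not_lt, ← not_lt, this]
    simp [h1, h2]
  simp_rw [flagCoord_eq_zero_iff, h']

end Coordinates

/-! ### Rescaling of a stratified simplex at an element of the poset -/

section Rescale

open Classical in
/-- The factor by which `rescale` multiplies the coordinates in the stratum `q`. -/
noncomputable def rescaleFactor (φ ψ : ControlFamily P) (p : P) {n : SimplexCategory}
    (σ : (nerve P).obj (op n)) (t : stdSimplex ℝ (Fin (n.len + 1))) (q : P) : ℝ :=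
  if q < p then 1 else
    flagCoord {q | ¬ q < p} σ t *
      (if q = p then φ.toFun p (flagCoord {q | ¬ q < p} σ t)
        else ψ.toFun p (flagCoord {q | ¬ q < p} σ t)) /
      (φ.toFun p (flagCoord {q | ¬ q < p} σ t) * flagCoord {p} σ t +
        ψ.toFun p (flagCoord {q | ¬ q < p} σ t) * flagCoord {q | ¬ q ≤ p} σ t)

variable (φ ψ : ControlFamily P) (p : P) {n : SimplexCategory} (σ : (nerve P).obj (op n))
  (t : stdSimplex ℝ (Fin (n.len + 1)))

/-- The common denominator of the rescaling factors. -/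
noncomputable def rescaleDenom : ℝ :=
  φ.toFun p (flagCoord {q | ¬ q < p} σ t) * flagCoord {p} σ t +
    ψ.toFun p (flagCoord {q | ¬ q < p} σ t) * flagCoord {q | ¬ q ≤ p} σ t

lemma rescaleFactor_of_lt {q : P} (h : q < p) : rescaleFactor φ ψ p σ t q = 1 := if_pos h

lemma rescaleFactor_self : rescaleFactor φ ψ p σ t p =
    flagCoord {q | ¬ q < p} σ t * φ.toFun p (flagCoord {q | ¬ q < p} σ t) /
      rescaleDenom φ ψ p σ t := by
  rw [rescaleFactor, if_neg (lt_irrefl p), if_pos rfl, rescaleDenom]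

lemma rescaleFactor_of_not_le {q : P} (h : ¬ q ≤ p) : rescaleFactor φ ψ p σ t q =
    flagCoord {q | ¬ q < p} σ t * ψ.toFun p (flagCoord {q | ¬ q < p} σ t) /
      rescaleDenom φ ψ p σ t := by
  rw [rescaleFactor, if_neg fun h' => h h'.le, if_neg fun h' => h h'.le, rescaleDenom]

lemma rescaleDenom_nonneg : 0 ≤ rescaleDenom φ ψ p σ t :=
  add_nonneg (mul_nonneg (φ.toFun p _).2.1 (flagCoord {p} σ t).2.1)
    (mul_nonneg (ψ.toFun p _).2.1 (flagCoord _ σ t).2.1)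

lemma rescaleDenom_pos (h : 0 < (flagCoord {q | ¬ q < p} σ t : ℝ)) :
    0 < rescaleDenom φ ψ p σ t := by
  have h1 : (0 : ℝ) < φ.toFun p (flagCoord {q | ¬ q < p} σ t) := φ.pos p _ h
  have h2 : (0 : ℝ) < ψ.toFun p (flagCoord {q | ¬ q < p} σ t) := ψ.pos p _ h
  have hs : (0 : ℝ) ≤ flagCoord {p} σ t := (flagCoord {p} σ t).2.1
  have hT : (0 : ℝ) ≤ flagCoord {q | ¬ q ≤ p} σ t := (flagCoord _ σ t).2.1
  have hS := flagCoord_not_lt σ t p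
  unfold rescaleDenom
  -- `s_p` and `s_{≰p}` add up to `s_{≮p} > 0`, so one of the two summands of the denominator is
  -- positive.
  rcases hs.eq_or_lt with hs | hs
  · have : (0 : ℝ) < flagCoord {q | ¬ q ≤ p} σ t := by linarith
    positivity
  · positivity

lemma rescaleFactor_nonneg (q : P) : 0 ≤ rescaleFactor φ ψ p σ t q := by
  have hS : (0 : ℝ) ≤ flagCoord {q | ¬ q < p} σ t := (flagCoord _ σ t).2.1
  by_cases h : q < p
  · rw [rescaleFactor_of_lt _ _ _ _ _ h]
    exact zero_le_one
  by_cases h' : q = p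
  · rw [h', rescaleFactor_self]
    exact div_nonneg (mul_nonneg hS (φ.toFun p _).2.1) (rescaleDenom_nonneg _ _ _ _ _)
  · rw [rescaleFactor_of_not_le _ _ _ _ _ fun h2 => h (lt_of_le_of_ne h2 h')]
    exact div_nonneg (mul_nonneg hS (ψ.toFun p _).2.1) (rescaleDenom_nonneg _ _ _ _ _)

/-- A positive coordinate outside the strata below `p` forces `s_{≮p} > 0`, hence a nonzero
denominator. Without it the factor may be the default value `0` of a division by zero. -/
lemma rescaleFactor_pos {i : Fin (n.len + 1)} (h : 0 < t i) :
    0 < rescaleFactor φ ψ p σ t (σ.obj i) := by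
  by_cases hlt : σ.obj i < p
  · rw [rescaleFactor_of_lt _ _ _ _ _ hlt]
    exact zero_lt_one
  have hS : (0 : ℝ) < flagCoord {q | ¬ q < p} σ t :=
    h.trans_le (le_flagCoord σ t hlt)
  have hD := rescaleDenom_pos φ ψ p σ t hS
  by_cases h' : σ.obj i = p
  · rw [h', rescaleFactor_self]
    exact div_pos (mul_pos hS (φ.pos p _ hS)) hD
  · rw [rescaleFactor_of_not_le _ _ _ _ _ fun h2 => hlt (lt_of_le_of_ne h2 h')]
    exact div_pos (mul_pos hS (ψ.pos p _ hS)) hD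

lemma sum_mul_indicator_of_const {Q : Set P} {w : P → ℝ} {c : ℝ} (h : ∀ q ∈ Q, w q = c) :
    ∑ i, t i * Q.indicator w (σ.obj i) = flagCoord Q σ t * c := by
  rw [flagCoord_eq_sum, Finset.sum_mul]
  refine Finset.sum_congr rfl fun i _ => ?_
  by_cases hi : σ.obj i ∈ Q
  · rw [Set.indicator_of_mem hi, Set.indicator_of_mem hi, h _ hi, Pi.one_apply, mul_one]
  · rw [Set.indicator_of_notMem hi, Set.indicator_of_notMem hi, mul_zero, zero_mul]

/-- The common part `s_{≮p} / D` of the factors is the normalization that makes the redistributed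
mass add up to `s_{≮p}` again. -/
lemma sum_rescale_not_lt :
    ∑ i, t i * {q | ¬ q < p}.indicator (rescaleFactor φ ψ p σ t) (σ.obj i) =
      flagCoord {q | ¬ q < p} σ t := by
  rw [setOf_not_lt_eq, Set.indicator_union_of_disjoint (disjoint_setOf_not_le p),
    ← setOf_not_lt_eq]
  simp_rw [mul_add, Finset.sum_add_distrib]
  rw [sum_mul_indicator_of_const σ t (fun q hq => by
      rw [Set.mem_singleton_iff.1 hq, rescaleFactor_self]),
    sum_mul_indicator_of_const σ t (Q := {q | ¬ q ≤ p})
      (fun q hq => rescaleFactor_of_not_le _ _ _ _ _ (Set.mem_ofPred.1 hq))]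
  -- If `s_{≮p} = 0`, the numerators of the factors vanish, whatever the denominator is.
  rcases (flagCoord {q | ¬ q < p} σ t).2.1.eq_or_lt with h0 | h0
  · rw [← h0]
    simp
  · have hD := (rescaleDenom_pos φ ψ p σ t h0).ne'
    field_simp
    rw [rescaleDenom]
    ring

/-- The self-map of a stratified simplex which fixes the coordinates in the strata below `p`,
preserves their complement `s_{≮ p}`, and multiplies the ratio `s_p : s_{≰ p}` by
`φ_p(s_{≮ p}) : ψ_p(s_{≮ p})`. -/
noncomputable def rescale : stdSimplex ℝ (Fin (n.len + 1)) :=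
  ⟨fun i => t i * rescaleFactor φ ψ p σ t (σ.obj i),
    fun i => mul_nonneg (t.2.1 i) (rescaleFactor_nonneg _ _ _ _ _ _), by
    -- The total mass `1` splits as `s_{<p} + s_{≮p}`. The first summand has factor `1` and the
    -- second is preserved as a total.
    have h := flagCoord_univ σ t
    rw [← Set.union_compl_self {q | q < p}, Set.compl_ofPred,
      flagCoord_union _ _ (disjoint_setOf_lt p), ← sum_rescale_not_lt φ ψ p σ t,
      ← mul_one (flagCoord {q | q < p} σ t : ℝ), ← sum_mul_indicator_of_const σ t (Q := {q | q < p})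
        (w := rescaleFactor φ ψ p σ t) (fun q hq => rescaleFactor_of_lt _ _ _ _ _
          (Set.mem_ofPred.1 hq)), ← Finset.sum_add_distrib] at h
    rw [← h]
    refine Finset.sum_congr rfl fun i _ => ?_
    have hi := congrFun (Set.indicator_union_of_disjoint (disjoint_setOf_lt p)
      (rescaleFactor φ ψ p σ t)) (σ.obj i)
    rw [← Set.compl_ofPred, Set.union_compl_self, Set.indicator_univ] at hi
    rw [← mul_add, ← Set.compl_ofPred, ← hi]⟩

lemma rescale_apply (i : Fin (n.len + 1)) :
    rescale φ ψ p σ t i = t i * rescaleFactor φ ψ p σ t (σ.obj i) := rfl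

lemma flagCoord_rescale (Q : Set P) : (flagCoord Q σ (rescale φ ψ p σ t) : ℝ) =
    ∑ i, t i * Q.indicator (rescaleFactor φ ψ p σ t) (σ.obj i) := by
  rw [flagCoord_eq_sum]
  refine Finset.sum_congr rfl fun i _ => ?_
  rw [rescale_apply, mul_assoc, ← Set.indicator_mul_right]
  simp

lemma flagCoord_rescale_of_const {Q : Set P} {c : ℝ}
    (h : ∀ q ∈ Q, rescaleFactor φ ψ p σ t q = c) :
    (flagCoord Q σ (rescale φ ψ p σ t) : ℝ) = flagCoord Q σ t * c := by
  rw [flagCoord_rescale, sum_mul_indicator_of_const σ t h]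

lemma flagCoord_rescale_of_subset_lt {Q : Set P} (h : Q ⊆ {q | q < p}) :
    flagCoord Q σ (rescale φ ψ p σ t) = flagCoord Q σ t := by
  apply Subtype.ext
  rw [flagCoord_rescale_of_const φ ψ p σ t fun q hq => rescaleFactor_of_lt _ _ _ _ _ (h hq),
    mul_one]

lemma flagCoord_rescale_not_lt :
    flagCoord {q | ¬ q < p} σ (rescale φ ψ p σ t) = flagCoord {q | ¬ q < p} σ t := by
  apply Subtype.ext
  rw [flagCoord_rescale, sum_rescale_not_lt]

/-- Mass moves only within `{q | ¬ q < p}`, which `Q` contains entirely; the rest of `Q` lies below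
`p`. -/
lemma flagCoord_rescale_of_superset {Q : Set P} (h : {q | ¬ q < p} ⊆ Q) :
    flagCoord Q σ (rescale φ ψ p σ t) = flagCoord Q σ t := by
  have hQ : Q = Q ∩ {q | q < p} ∪ {q | ¬ q < p} := by
    ext q
    by_cases hq : q < p
    · simp [hq]
    · simpa [hq] using h hq
  have hd : Disjoint (Q ∩ {q | q < p}) {q | ¬ q < p} :=
    (disjoint_setOf_lt p).mono_left Set.inter_subset_right
  rw [hQ]
  apply Subtype.ext
  rw [flagCoord_union _ _ hd, flagCoord_union _ _ hd, flagCoord_rescale_not_lt,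
    flagCoord_rescale_of_subset_lt _ _ _ _ _ Set.inter_subset_right]

lemma flagCoord_rescale_self :
    (flagCoord {p} σ (rescale φ ψ p σ t) : ℝ) = flagCoord {p} σ t *
      (flagCoord {q | ¬ q < p} σ t * φ.toFun p (flagCoord {q | ¬ q < p} σ t) /
        rescaleDenom φ ψ p σ t) :=
  flagCoord_rescale_of_const φ ψ p σ t fun q hq => by rw [hq, rescaleFactor_self]

lemma flagCoord_rescale_of_subset_not_le {Q : Set P} (h : Q ⊆ {q | ¬ q ≤ p}) :
    (flagCoord Q σ (rescale φ ψ p σ t) : ℝ) = flagCoord Q σ t *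
      (flagCoord {q | ¬ q < p} σ t * ψ.toFun p (flagCoord {q | ¬ q < p} σ t) /
        rescaleDenom φ ψ p σ t) :=
  flagCoord_rescale_of_const φ ψ p σ t fun _ hq => rescaleFactor_of_not_le _ _ _ _ _ (h hq)

lemma rescale_pos_iff (i : Fin (n.len + 1)) : 0 < rescale φ ψ p σ t i ↔ 0 < t i := by
  rw [rescale_apply]
  constructor
  · intro h
    exact lt_of_le_of_ne (t.2.1 i) fun h0 => by
      have h0' : t i = 0 := h0.symm
      simp [h0'] at h
  · intro h
    exact mul_pos h (rescaleFactor_pos φ ψ p σ t h)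

/-- Both maps evaluate the control functions at the same number, since `s_{≮p}` is preserved;
exchanging `φ` and `ψ` therefore inverts the change of ratio. -/
lemma rescale_rescale : rescale ψ φ p σ (rescale φ ψ p σ t) = t := by
  ext i
  rw [rescale_apply, rescale_apply]
  rcases (t.2.1 i).eq_or_lt with h0 | h0
  · have h0' : t i = 0 := h0.symm
    simp [h0']
  by_cases hlt : σ.obj i < p
  · rw [rescaleFactor_of_lt _ _ _ _ _ hlt, rescaleFactor_of_lt _ _ _ _ _ hlt, mul_one, mul_one]
  have hS : (0 : ℝ) < flagCoord {q | ¬ q < p} σ t :=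
    lt_of_lt_of_le h0 (le_flagCoord σ t hlt)
  have ha : (0 : ℝ) < φ.toFun p (flagCoord {q | ¬ q < p} σ t) := φ.pos p _ hS
  have hb : (0 : ℝ) < ψ.toFun p (flagCoord {q | ¬ q < p} σ t) := ψ.pos p _ hS
  have hD := rescaleDenom_pos φ ψ p σ t hS
  -- With `s = s_{≮p}` the second denominator is `φ ψ s² / D`, so the product of the two factors is
  -- `1`.
  have hD' : rescaleDenom ψ φ p σ (rescale φ ψ p σ t) =
      φ.toFun p (flagCoord {q | ¬ q < p} σ t) * ψ.toFun p (flagCoord {q | ¬ q < p} σ t) *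
        (flagCoord {q | ¬ q < p} σ t * flagCoord {q | ¬ q < p} σ t) /
          rescaleDenom φ ψ p σ t := by
    rw [rescaleDenom, flagCoord_rescale_not_lt, flagCoord_rescale_self,
      flagCoord_rescale_of_subset_not_le _ _ _ _ _ subset_rfl]
    have hs : (flagCoord {p} σ t : ℝ) =
        flagCoord {q | ¬ q < p} σ t - flagCoord {q | ¬ q ≤ p} σ t := by
      rw [flagCoord_not_lt, add_sub_cancel_right]
    rw [hs]
    ring
  by_cases h' : σ.obj i = p
  · rw [h', rescaleFactor_self, rescaleFactor_self, hD', flagCoord_rescale_not_lt]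
    field_simp
  · have h2 : ¬ σ.obj i ≤ p := fun h2 => hlt (lt_of_le_of_ne h2 h')
    rw [rescaleFactor_of_not_le _ _ _ _ _ h2, rescaleFactor_of_not_le _ _ _ _ _ h2, hD',
      flagCoord_rescale_not_lt]
    field_simp

lemma rescale_same : rescale φ φ p σ t = t := by
  ext i
  rw [rescale_apply]
  rcases (t.2.1 i).eq_or_lt with h0 | h0
  · have h0' : t i = 0 := h0.symm
    simp [h0']
  by_cases hlt : σ.obj i < p
  · rw [rescaleFactor_of_lt _ _ _ _ _ hlt, mul_one]
  have hS : (0 : ℝ) < flagCoord {q | ¬ q < p} σ t :=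
    lt_of_lt_of_le h0 (le_flagCoord σ t hlt)
  have ha : (0 : ℝ) < φ.toFun p (flagCoord {q | ¬ q < p} σ t) := φ.pos p _ hS
  have hD : rescaleDenom φ φ p σ t =
      flagCoord {q | ¬ q < p} σ t * φ.toFun p (flagCoord {q | ¬ q < p} σ t) := by
    rw [rescaleDenom, ← mul_add, ← flagCoord_not_lt, mul_comm]
  rw [rescaleFactor, if_neg hlt, ite_self, ← rescaleDenom, hD, div_self (mul_pos hS ha).ne',
    mul_one]

/-- Here `s_p = 0`, so there is no ratio to change, and preservation of `s_{≮p}` leaves the factor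
`1`. This is what makes a composite over a flag compatible with passing to faces. -/
lemma rescale_of_notMem_range (h : ∀ i : Fin (n.len + 1), σ.obj i ≠ p) :
    rescale φ ψ p σ t = t := by
  ext i
  rw [rescale_apply]
  rcases (t.2.1 i).eq_or_lt with h0 | h0
  · have h0' : t i = 0 := h0.symm
    simp [h0']
  by_cases hlt : σ.obj i < p
  · rw [rescaleFactor_of_lt _ _ _ _ _ hlt, mul_one]
  have hS : (0 : ℝ) < flagCoord {q | ¬ q < p} σ t :=
    lt_of_lt_of_le h0 (le_flagCoord σ t hlt)
  have hb : (0 : ℝ) < ψ.toFun p (flagCoord {q | ¬ q < p} σ t) := ψ.pos p _ hS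
  have hs : (flagCoord {p} σ t : ℝ) = 0 :=
    (flagCoord_eq_zero_iff σ t).2 fun j hj => absurd hj (h j)
  have hD : rescaleDenom φ ψ p σ t =
      flagCoord {q | ¬ q < p} σ t * ψ.toFun p (flagCoord {q | ¬ q < p} σ t) := by
    rw [rescaleDenom, hs, mul_zero, zero_add, mul_comm]
    congr 1
    rw [flagCoord_not_lt, hs, zero_add]
  rw [rescaleFactor_of_not_le _ _ _ _ _ fun h2 => hlt (lt_of_le_of_ne h2 (h i)), hD,
    div_self (mul_pos hS hb).ne', mul_one]

/-- The factors depend only on the coordinates `s_Q`, which are invariant under simplicial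
operators, and on the stratum of the vertex, which is constant on the fibres of `g`. -/
lemma map_rescale {m : SimplexCategory} (g : m ⟶ n) (t : stdSimplex ℝ (Fin (m.len + 1))) :
    stdSimplex.map g (rescale φ ψ p ((nerve P).map g.op σ) t) =
      rescale φ ψ p σ (stdSimplex.map g t) := by
  classical
  have hw (q : P) : rescaleFactor φ ψ p ((nerve P).map g.op σ) t q =
      rescaleFactor φ ψ p σ (stdSimplex.map g t) q := by
    simp only [rescaleFactor, flagCoord_map]
  ext j
  change stdSimplex.map g (rescale φ ψ p ((nerve P).map g.op σ) t) j =
    rescale φ ψ p σ (stdSimplex.map g t) j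
  rw [rescale_apply, stdSimplex_map_apply, stdSimplex_map_apply, Finset.sum_mul]
  refine Finset.sum_congr rfl fun i hi => ?_
  rw [rescale_apply, hw, ← (Finset.mem_filter.1 hi).2]
  rfl

end Rescale

/-- Rescaling depends continuously on the point and on the control families. -/
lemma continuous_rescale {Z : Type*} [TopologicalSpace Z] {n : SimplexCategory}
    (σ : (nerve P).obj (op n)) (p : P) {φ ψ : Z → ControlFamily P}
    (hφ : Continuous fun z : Z × unitInterval => (φ z.1).toFun p z.2)
    (hψ : Continuous fun z : Z × unitInterval => (ψ z.1).toFun p z.2)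
    {x : Z → stdSimplex ℝ (Fin (n.len + 1))} (hx : Continuous x) :
    Continuous fun z => rescale (φ z) (ψ z) p σ (x z) := by
  have hc (Q : Set P) : Continuous fun z => (flagCoord Q σ (x z) : ℝ) :=
    continuous_subtype_val.comp ((continuous_flagCoord σ Q).comp hx)
  have ha : Continuous fun z =>
      ((φ z).toFun p (flagCoord {q | ¬ q < p} σ (x z)) : ℝ) :=
    continuous_subtype_val.comp
      (hφ.comp (continuous_id.prodMk ((continuous_flagCoord σ _).comp hx)))
  have hb : Continuous fun z =>
      ((ψ z).toFun p (flagCoord {q | ¬ q < p} σ (x z)) : ℝ) :=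
    continuous_subtype_val.comp
      (hψ.comp (continuous_id.prodMk ((continuous_flagCoord σ _).comp hx)))
  have hD : Continuous fun z => rescaleDenom (φ z) (ψ z) p σ (x z) :=
    (ha.mul (hc _)).add (hb.mul (hc _))
  have hi (i : Fin (n.len + 1)) : Continuous fun z => x z i :=
    (continuous_apply i).comp (continuous_subtype_val.comp hx)
  refine Continuous.subtype_mk (continuous_pi fun i => ?_) _
  by_cases hlt : σ.obj i < p
  · simp_rw [rescaleFactor_of_lt _ _ _ _ _ hlt, mul_one]
    exact hi i
  rw [continuous_iff_continuousAt]
  intro z₀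
  rcases (flagCoord {q | ¬ q < p} σ (x z₀)).2.1.eq_or_lt with h0 | h0
  -- Where `s_{≮p} = 0` the quotient need not be continuous, but each rescaled coordinate is
  -- squeezed between `0` and `s_{≮p}`.
  · have hle (z : Z) : x z i * rescaleFactor (φ z) (ψ z) p σ (x z) (σ.obj i) ≤
        flagCoord {q | ¬ q < p} σ (x z) := by
      rw [← flagCoord_rescale_not_lt (φ z) (ψ z)]
      exact le_flagCoord σ (rescale (φ z) (ψ z) p σ (x z)) hlt
    have hz : x z₀ i * rescaleFactor (φ z₀) (ψ z₀) p σ (x z₀) (σ.obj i) = 0 :=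
      le_antisymm ((hle z₀).trans_eq h0.symm)
        (mul_nonneg ((x z₀).2.1 i) (rescaleFactor_nonneg _ _ _ _ _ _))
    change Filter.Tendsto _ _ (nhds (x z₀ i * rescaleFactor (φ z₀) (ψ z₀) p σ (x z₀) (σ.obj i)))
    rw [hz]
    refine squeeze_zero (fun z => mul_nonneg ((x z).2.1 i) (rescaleFactor_nonneg _ _ _ _ _ _))
      hle ?_
    have := (hc {q | ¬ q < p}).tendsto z₀
    rwa [← h0] at this
  · have hD0 := (rescaleDenom_pos (φ z₀) (ψ z₀) p σ (x z₀) h0).ne'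
    by_cases h' : σ.obj i = p
    · simp_rw [h', rescaleFactor_self]
      exact (hi i).continuousAt.mul
        (((hc _).mul ha).continuousAt.div hD.continuousAt hD0)
    · simp_rw [rescaleFactor_of_not_le _ _ _ _ _ fun h2 => hlt (lt_of_le_of_ne h2 h')]
      exact (hi i).continuousAt.mul
        (((hc _).mul hb).continuousAt.div hD.continuousAt hD0)

/-! ### Composition of rescalings along a flag -/

section RescaleList

variable (φ : ControlFamily P) {n : SimplexCategory} (σ : (nerve P).obj (op n))

/-- The rescaling of the ratio `s_p : s_{≰ p}` by `1 : φ_p(s_{≮ p})`, as a bijection. -/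
noncomputable def rescaleEquiv (p : P) :
    stdSimplex ℝ (Fin (n.len + 1)) ≃ stdSimplex ℝ (Fin (n.len + 1)) where
  toFun := rescale (.one P) φ p σ
  invFun := rescale φ (.one P) p σ
  left_inv := rescale_rescale _ _ p σ
  right_inv := rescale_rescale _ _ p σ

/-- The composition of the rescalings at the elements of a list, the head of the list first. -/
noncomputable def rescaleList (L : List P) :
    stdSimplex ℝ (Fin (n.len + 1)) ≃ stdSimplex ℝ (Fin (n.len + 1)) :=
  L.foldr (fun p e => (rescaleEquiv φ σ p).trans e) (Equiv.refl _)

variable (t : stdSimplex ℝ (Fin (n.len + 1)))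

lemma rescaleList_cons (p : P) (L : List P) : rescaleList φ σ (p :: L) t =
    rescaleList φ σ L (rescale (.one P) φ p σ t) := rfl

lemma rescaleList_append (L L' : List P) :
    rescaleList φ σ (L ++ L') t = rescaleList φ σ L' (rescaleList φ σ L t) := by
  induction L generalizing t with
  | nil => rfl
  | cons p L ih =>
    rw [List.cons_append, rescaleList_cons, rescaleList_cons, ih]

lemma rescaleList_pos_iff (L : List P) (i : Fin (n.len + 1)) :
    0 < rescaleList φ σ L t i ↔ 0 < t i := by
  induction L generalizing t with
  | nil => rfl
  | cons p L ih => rw [rescaleList_cons, ih, rescale_pos_iff]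

lemma rescaleList_one (L : List P) : rescaleList (.one P) σ L t = t := by
  induction L with
  | nil => rfl
  | cons p L ih => rw [rescaleList_cons, rescale_same, ih]

lemma map_rescaleList {m : SimplexCategory} (g : m ⟶ n) (L : List P)
    (t : stdSimplex ℝ (Fin (m.len + 1))) :
    stdSimplex.map g (rescaleList φ ((nerve P).map g.op σ) L t) =
      rescaleList φ σ L (stdSimplex.map g t) := by
  induction L generalizing t with
  | nil => rfl
  | cons p L ih => rw [rescaleList_cons, rescaleList_cons, ih, map_rescale]

-- Elements outside the flag contribute identities, so the list of a larger flag may be used for a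
-- face.
open Classical in
lemma rescaleList_filter (L : List P) :
    rescaleList φ σ (L.filter fun p => ∃ i : Fin (n.len + 1), σ.obj i = p) t =
      rescaleList φ σ L t := by
  induction L generalizing t with
  | nil => rfl
  | cons p L ih =>
    by_cases hp : ∃ i : Fin (n.len + 1), σ.obj i = p
    · rw [List.filter_cons_of_pos (by simpa using hp), rescaleList_cons, rescaleList_cons, ih]
    · rw [List.filter_cons_of_neg (by simpa using hp), rescaleList_cons, ih,
        rescale_of_notMem_range _ _ _ _ _ fun i hi => hp ⟨i, hi⟩]

lemma continuous_rescaleList {Z : Type*} [TopologicalSpace Z] {φ : Z → ControlFamily P}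
    (hφ : ∀ p, Continuous fun z : Z × unitInterval => (φ z.1).toFun p z.2) (L : List P)
    {x : Z → stdSimplex ℝ (Fin (n.len + 1))} (hx : Continuous x) :
    Continuous fun z => rescaleList (φ z) σ L (x z) := by
  induction L generalizing x with
  | nil => exact hx
  | cons p L ih => exact ih (continuous_rescale σ p continuous_const (hφ p) hx)

/-- For `r < p`, both `{p}` and `{q | ¬ q ≤ p}` lie in `{q | ¬ q ≤ r}`, so the rescaling at `r`
multiplies both coordinates by one nonnegative factor. -/
lemma flagCoord_not_le_le_rescaleList {L : List P} {p : P} (hL : ∀ q ∈ L, q < p)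
    (h : (flagCoord {q | ¬ q ≤ p} σ t : ℝ) ≤ flagCoord {p} σ t) :
    (flagCoord {q | ¬ q ≤ p} σ (rescaleList φ σ L t) : ℝ) ≤
      flagCoord {p} σ (rescaleList φ σ L t) := by
  induction L generalizing t with
  | nil => exact h
  | cons r L ih =>
    have hr : r < p := hL r List.mem_cons_self
    refine ih _ (fun q hq => hL q (List.mem_cons_of_mem _ hq)) ?_
    change (flagCoord {q | ¬ q ≤ p} σ (rescale (.one P) φ r σ t) : ℝ) ≤
      flagCoord {p} σ (rescale (.one P) φ r σ t)
    rw [flagCoord_rescale_of_subset_not_le, flagCoord_rescale_of_subset_not_le]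
    · exact mul_le_mul_of_nonneg_right h (div_nonneg
        (mul_nonneg (flagCoord _ σ t).2.1 (φ.toFun r _).2.1) (rescaleDenom_nonneg _ _ _ _ _))
    · exact Set.singleton_subset_iff.2 hr.not_ge
    · exact fun q hq hqr => Set.mem_ofPred.1 hq (hqr.trans hr.le)

/-- For `r > p`, the set `{p}` lies below `r`, while the other two sets contain all of `{q | ¬ q <
r}`; the rescaling at `r` fixes coordinates of both kinds. -/
lemma flagCoord_rescaleList_of_gt {L : List P} {p : P} (hL : ∀ q ∈ L, p < q) :
    flagCoord {p} σ (rescaleList φ σ L t) = flagCoord {p} σ t ∧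
    flagCoord {q | ¬ q ≤ p} σ (rescaleList φ σ L t) = flagCoord {q | ¬ q ≤ p} σ t ∧
    flagCoord {q | ¬ q < p} σ (rescaleList φ σ L t) = flagCoord {q | ¬ q < p} σ t := by
  induction L generalizing t with
  | nil => exact ⟨rfl, rfl, rfl⟩
  | cons r L ih =>
    have hr : p < r := hL r List.mem_cons_self
    obtain ⟨h1, h2, h3⟩ := ih (rescale (.one P) φ r σ t)
      fun q hq => hL q (List.mem_cons_of_mem _ hq)
    simp_rw [rescaleList_cons, h1, h2, h3]
    refine ⟨flagCoord_rescale_of_subset_lt _ _ _ _ _ (Set.singleton_subset_iff.2 hr),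
      flagCoord_rescale_of_superset _ _ _ _ _ fun q hq hqp => ?_,
      flagCoord_rescale_of_superset _ _ _ _ _ fun q hq hqp => ?_⟩
    · exact Set.mem_ofPred.1 hq (hqp.trans_lt hr)
    · exact Set.mem_ofPred.1 hq (hqp.trans hr)

/-- Multiply the hypothesis by the factor of `s_{≰p}`: it is `φ_p(s_{≮p})` times the factor of
`s_p`. -/
lemma flagCoord_not_le_rescale_le (p : P)
    (h : (flagCoord {q | ¬ q ≤ p} σ t : ℝ) ≤ flagCoord {p} σ t) :
    (flagCoord {q | ¬ q ≤ p} σ (rescale (.one P) φ p σ t) : ℝ) ≤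
      φ.toFun p (flagCoord {q | ¬ q < p} σ (rescale (.one P) φ p σ t)) *
        flagCoord {p} σ (rescale (.one P) φ p σ t) := by
  rw [flagCoord_rescale_not_lt, flagCoord_rescale_self,
    flagCoord_rescale_of_subset_not_le _ _ _ _ _ subset_rfl]
  have h1 : (((ControlFamily.one P).toFun p (flagCoord {q | ¬ q < p} σ t) : unitInterval) : ℝ) =
    1 := rfl
  rw [h1, mul_one]
  have h2 : (0 : ℝ) ≤ flagCoord {q | ¬ q < p} σ t *
      φ.toFun p (flagCoord {q | ¬ q < p} σ t) / rescaleDenom (.one P) φ p σ t :=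
    div_nonneg (mul_nonneg (flagCoord _ σ t).2.1 (φ.toFun p _).2.1)
      (rescaleDenom_nonneg _ _ _ _ _)
  refine (mul_le_mul_of_nonneg_right h h2).trans_eq ?_
  ring

end RescaleList

/-! ### The natural automorphism of stratified simplices attached to a control family -/

section FlagFlow

variable (φ : ControlFamily P) {n : SimplexCategory} (σ : (nerve P).obj (op n))

open Classical in
/-- The values of a flag, without repetitions and in increasing order. -/
noncomputable def flagValues : List P := (List.ofFn fun i : Fin (n.len + 1) => σ.obj i).dedup

lemma mem_flagValues {p : P} : p ∈ flagValues σ ↔ ∃ i : Fin (n.len + 1), σ.obj i = p := by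
  classical
  rw [flagValues, List.mem_dedup, List.mem_ofFn']
  rfl

lemma flagValues_pairwise : (flagValues σ).Pairwise (· < ·) := by
  classical
  have h : (List.ofFn fun i : Fin (n.len + 1) => σ.obj i).Pairwise (· ≤ ·) :=
    List.pairwise_ofFn.2 fun i j hij => leOfHom (σ.map (homOfLE hij.le))
  refine (List.Pairwise.and (h.sublist (List.dedup_sublist _)) (List.nodup_dedup _)).imp ?_
  exact fun h => lt_of_le_of_ne h.1 h.2

open Classical in
lemma flagValues_map {m : SimplexCategory} (g : m ⟶ n) :
    flagValues ((nerve P).map g.op σ) = (flagValues σ).filter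
      fun p => ∃ i : Fin (m.len + 1), ((nerve P).map g.op σ).obj i = p := by
  have h1 := flagValues_pairwise ((nerve P).map g.op σ)
  have h2 := (flagValues_pairwise σ).filter
    fun p => decide (∃ i : Fin (m.len + 1), ((nerve P).map g.op σ).obj i = p)
  -- Strictly increasing lists with the same elements are equal.
  refine List.Perm.eq_of_pairwise (fun a b _ _ hab hba => absurd hba hab.asymm) h1 h2
    ((List.perm_ext_iff_of_nodup (h1.imp fun h => h.ne) (h2.imp fun h => h.ne)).2 fun p => ?_)
  rw [List.mem_filter, mem_flagValues, mem_flagValues, decide_eq_true_iff]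
  exact ⟨fun h => ⟨h.imp' g fun i hi => hi, h⟩, fun h => h.2⟩

/-- The composition of the rescalings at all the elements of a flag, in increasing order. -/
noncomputable def flagFlow :
    stdSimplex ℝ (Fin (n.len + 1)) ≃ stdSimplex ℝ (Fin (n.len + 1)) :=
  rescaleList φ σ (flagValues σ)

lemma map_flagFlow {m : SimplexCategory} (g : m ⟶ n) (t : stdSimplex ℝ (Fin (m.len + 1))) :
    stdSimplex.map g (flagFlow φ ((nerve P).map g.op σ) t) =
      flagFlow φ σ (stdSimplex.map g t) := by
  rw [flagFlow, flagValues_map, rescaleList_filter, map_rescaleList, flagFlow]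

/-- The increasing order is essential: the list splits at `p` into rescalings that preserve the
hypothesis, the one that creates the conclusion, and those that preserve the conclusion. -/
lemma flagFlow_mem (t : stdSimplex ℝ (Fin (n.len + 1))) (p : P)
    (h : (flagCoord {q | ¬ q ≤ p} σ t : ℝ) ≤ flagCoord {p} σ t) :
    (flagCoord {q | ¬ q ≤ p} σ (flagFlow φ σ t) : ℝ) ≤
      φ.toFun p (flagCoord {q | ¬ q < p} σ (flagFlow φ σ t)) *
        flagCoord {p} σ (flagFlow φ σ t) := by
  by_cases hp : p ∈ flagValues σ
  · obtain ⟨L, L', hL⟩ := List.append_of_mem hp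
    have hs := flagValues_pairwise σ
    rw [hL, List.pairwise_append, List.pairwise_cons] at hs
    rw [flagFlow, hL, rescaleList_append, rescaleList_cons]
    obtain ⟨h1, h2, h3⟩ := flagCoord_rescaleList_of_gt φ σ
      (rescale (.one P) φ p σ (rescaleList φ σ L t)) hs.2.1.1
    rw [h1, h2, h3]
    exact flagCoord_not_le_rescale_le φ σ _ p (flagCoord_not_le_le_rescaleList φ σ t
      (fun q hq => hs.2.2 q hq p List.mem_cons_self) h)
  -- If `p` is not in the flag, then `s_p = 0`, so the hypothesis forces `s_{≰p} = 0`; vanishing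
  -- persists because supports are preserved.
  · have hs : (flagCoord {p} σ t : ℝ) = 0 := (flagCoord_eq_zero_iff σ t).2 fun i hi =>
      absurd ((mem_flagValues σ).2 ⟨i, hi⟩) hp
    have hT : (flagCoord {q | ¬ q ≤ p} σ t : ℝ) = 0 :=
      le_antisymm (h.trans_eq hs) (flagCoord _ σ t).2.1
    rw [flagFlow, (flagCoord_eq_zero_congr σ (rescaleList_pos_iff φ σ t (flagValues σ))).2 hT]
    exact mul_nonneg (φ.toFun p _).2.1 (flagCoord _ σ _).2.1

end FlagFlow

/-! ### Gluing natural automorphisms of stratified simplices -/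

section Gluing

lemma simplexPoint_map {X : SSet.{u}} {m n : SimplexCategory} (g : m ⟶ n) (σ : X.obj (op n))
    (t : stdSimplex ℝ (Fin (m.len + 1))) :
    simplexPoint (X.map g.op σ) t = simplexPoint σ (stdSimplex.map g t) := by
  have h := NatTrans.naturality_apply (sSetTopAdj.unit.app X) g.op σ
  exact congrArg (fun y => TopCat.toSSetObjEquiv _ (op m) y t) h

lemma continuous_simplexPoint {X : SSet.{u}} {n : SimplexCategory} (σ : X.obj (op n)) :
    Continuous (simplexPoint σ) :=
  (TopCat.toSSetObjEquiv _ _ ((sSetTopAdj.unit.app X).app (op n) σ)).continuous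

lemma toTop_map_simplexPoint {X Y : SSet.{u}} (f : X ⟶ Y) {n : SimplexCategory}
    (σ : X.obj (op n)) (t : stdSimplex ℝ (Fin (n.len + 1))) :
    SSet.toTop.map f (simplexPoint σ t) = simplexPoint (f.app (op n) σ) t := by
  have h := congrArg (fun F => F.app (op n) σ) (sSetTopAdj.unit.naturality f)
  exact (congrArg (fun y => TopCat.toSSetObjEquiv _ (op n) y t) h).symm

lemma toTop_hom_ext {X : SSet.{u}} {T : TopCat.{u}} {F G : SSet.toTop.obj X ⟶ T}
    (h : ∀ (n : SimplexCategory) (σ : X.obj (op n)) (t : stdSimplex ℝ (Fin (n.len + 1))),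
      F (simplexPoint σ t) = G (simplexPoint σ t)) : F = G := by
  ext x
  obtain ⟨n, σ, t, rfl⟩ := exists_simplexPoint x
  exact h n σ t

/-- A natural family of continuous maps on simplices glues to a continuous map on `|X|`. -/
lemma exists_continuousMap_simplexPoint {X : SSet.{u}} {T : Type u} [TopologicalSpace T]
    (f : ∀ n : SimplexCategory, X.obj (op n) → stdSimplex ℝ (Fin (n.len + 1)) → T)
    (hc : ∀ n σ, Continuous (f n σ))
    (hf : ∀ (m n : SimplexCategory) (g : m ⟶ n) (σ : X.obj (op n))
      (t : stdSimplex ℝ (Fin (m.len + 1))),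
      f m (X.map g.op σ) t = f n σ (stdSimplex.map g t)) :
    ∃ G : C(SSet.toTop.obj X, T), ∀ n σ t, G (simplexPoint σ t) = f n σ t :=
  ⟨(realizationDesc (T := TopCat.of T) (fun n σ => ⟨f n σ, hc n σ⟩) hf).hom,
    fun _ σ t => realizationDesc_simplexPoint (T := TopCat.of T) _ _ σ t⟩

/-- The flag of `P` underlying a simplex of a stratified simplicial set. -/
abbrev flag (X : StratSSet P) {n : SimplexCategory} (τ : X.left.obj (op n)) :
    (nerve P).obj (op n) := X.hom.app (op n) τ

lemma flag_map (X : StratSSet P) {m n : SimplexCategory} (g : m ⟶ n) (τ : X.left.obj (op n)) :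
    flag X (X.left.map g.op τ) = (nerve P).map g.op (flag X τ) :=
  NatTrans.naturality_apply X.hom g.op τ

lemma flag_app {X Y : StratSSet P} (f : X ⟶ Y) {n : SimplexCategory} (τ : X.left.obj (op n)) :
    flag Y (f.left.app (op n) τ) = flag X τ :=
  congrArg (fun F => F.app (op n) τ) (Over.w f)

lemma sCoord_simplexPoint (X : StratSSet P) (Q : Set P) {n : SimplexCategory}
    (τ : X.left.obj (op n)) (t : stdSimplex ℝ (Fin (n.len + 1))) :
    sCoord X Q (simplexPoint τ t) = flagCoord Q (flag X τ) t := by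
  have h := (congrArg (nerveCoord Q) (toTop_map_simplexPoint X.hom τ t)).trans
    (realizationDesc_simplexPoint _ _ (flag X τ) t)
  exact congrArg ULift.down h

lemma sReal_hom_simplexPoint (X : StratSSet P) {n : SimplexCategory}
    (τ : X.left.obj (op n)) (t : stdSimplex ℝ (Fin (n.len + 1))) :
    ((sReal P).obj X).hom (simplexPoint τ t) =
      Topology.WithUpperSet.toUpperSet (flagSup (flag X τ) t) :=
  (congrArg (nerveStratification P) (toTop_map_simplexPoint X.hom τ t)).trans
    (realizationDesc_simplexPoint _ _ (flag X τ) t)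

variable (P) in
/-- Families of stratum-preserving self-homeomorphisms of the stratified simplices which are
natural with respect to the simplicial operators. -/
structure SimplexAut where
  toHomeo {n : SimplexCategory} (σ : (nerve P).obj (op n)) :
    stdSimplex ℝ (Fin (n.len + 1)) ≃ₜ stdSimplex ℝ (Fin (n.len + 1))
  map_toHomeo {m n : SimplexCategory} (g : m ⟶ n) (σ : (nerve P).obj (op n))
    (t : stdSimplex ℝ (Fin (m.len + 1))) :
    stdSimplex.map g (toHomeo ((nerve P).map g.op σ) t) = toHomeo σ (stdSimplex.map g t)
  flagSup_toHomeo {n : SimplexCategory} (σ : (nerve P).obj (op n))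
    (t : stdSimplex ℝ (Fin (n.len + 1))) : flagSup σ (toHomeo σ t) = flagSup σ t

namespace SimplexAut

/-- The inverse family. -/
noncomputable def symm (E : SimplexAut P) : SimplexAut P where
  toHomeo σ := (E.toHomeo σ).symm
  map_toHomeo g σ t := by
    rw [Homeomorph.eq_symm_apply, ← E.map_toHomeo, Homeomorph.apply_symm_apply]
  flagSup_toHomeo σ t := by
    rw [← E.flagSup_toHomeo, Homeomorph.apply_symm_apply]

/-- The self-map of `|X|` glued from a natural family of self-homeomorphisms of simplices. -/
noncomputable def realize (E : SimplexAut P) (X : StratSSet P) :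
    SSet.toTop.obj X.left ⟶ SSet.toTop.obj X.left :=
  realizationDesc (fun _ τ => ⟨fun t => simplexPoint τ (E.toHomeo (flag X τ) t),
    (continuous_simplexPoint τ).comp (E.toHomeo (flag X τ)).continuous⟩) fun m n g τ t => by
      change simplexPoint (X.left.map g.op τ) (E.toHomeo (flag X (X.left.map g.op τ)) t) =
        simplexPoint τ (E.toHomeo (flag X τ) (stdSimplex.map g t))
      rw [simplexPoint_map, flag_map, E.map_toHomeo]

lemma realize_simplexPoint (E : SimplexAut P) (X : StratSSet P) {n : SimplexCategory}
    (τ : X.left.obj (op n)) (t : stdSimplex ℝ (Fin (n.len + 1))) :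
    E.realize X (simplexPoint τ t) = simplexPoint τ (E.toHomeo (flag X τ) t) :=
  realizationDesc_simplexPoint _ _ τ t

/-- The natural transformation glued from a natural family of self-homeomorphisms. -/
noncomputable def hom (E : SimplexAut P) : sReal P ⟶ sReal P where
  app X := Over.homMk (E.realize X) (toTop_hom_ext fun n τ t => by
    change ((sReal P).obj X).hom (E.realize X (simplexPoint τ t)) =
      ((sReal P).obj X).hom (simplexPoint τ t)
    rw [realize_simplexPoint, sReal_hom_simplexPoint, sReal_hom_simplexPoint,
      E.flagSup_toHomeo])
  naturality X Y f := by
    apply Over.OverMorphism.ext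
    refine toTop_hom_ext fun n τ t => ?_
    change E.realize Y (SSet.toTop.map f.left (simplexPoint τ t)) =
      SSet.toTop.map f.left (E.realize X (simplexPoint τ t))
    rw [realize_simplexPoint, toTop_map_simplexPoint, toTop_map_simplexPoint,
      realize_simplexPoint, flag_app]

lemma hom_comp_symm_hom (E : SimplexAut P) : E.hom ≫ E.symm.hom = 𝟙 (sReal P) := by
  ext X : 2
  apply Over.OverMorphism.ext
  refine toTop_hom_ext fun n τ t => ?_
  change E.symm.realize X (E.realize X (simplexPoint τ t)) = simplexPoint τ t
  rw [realize_simplexPoint, realize_simplexPoint]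
  exact congrArg _ (Homeomorph.symm_apply_apply _ t)

lemma symm_hom_comp_hom (E : SimplexAut P) : E.symm.hom ≫ E.hom = 𝟙 (sReal P) := by
  ext X : 2
  apply Over.OverMorphism.ext
  refine toTop_hom_ext fun n τ t => ?_
  change E.realize X (E.symm.realize X (simplexPoint τ t)) = simplexPoint τ t
  rw [realize_simplexPoint, realize_simplexPoint]
  exact congrArg _ (Homeomorph.apply_symm_apply _ t)

/-- The natural automorphism of stratified realization glued from a natural family of
self-homeomorphisms of the stratified simplices. -/
noncomputable def iso (E : SimplexAut P) : sReal P ≅ sReal P where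
  hom := E.hom
  inv := E.symm.hom
  hom_inv_id := E.hom_comp_symm_hom
  inv_hom_id := E.symm_hom_comp_hom

lemma iso_hom_app_simplexPoint (E : SimplexAut P) (X : StratSSet P) {n : SimplexCategory}
    (τ : X.left.obj (op n)) (t : stdSimplex ℝ (Fin (n.len + 1))) :
    (E.iso.hom.app X).left (simplexPoint τ t) = simplexPoint τ (E.toHomeo (flag X τ) t) :=
  E.realize_simplexPoint X τ t

lemma iso_eq_refl (E : SimplexAut P)
    (h : ∀ {n : SimplexCategory} (σ : (nerve P).obj (op n)) t, E.toHomeo σ t = t) :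
    E.iso = Iso.refl _ := by
  ext X : 3
  apply Over.OverMorphism.ext
  refine toTop_hom_ext fun n τ t => ?_
  exact (iso_hom_app_simplexPoint E X τ t).trans (congrArg _ (h _ t))

/-- Gluing yields maps out of `|X|`, not out of `|X| × [0,1]`. Hence the homotopy is glued as a map
into `C([0,1], |X|)` and then uncurried, which is continuous because `[0,1]` is locally compact. -/
lemma continuous_realize (E : unitInterval → SimplexAut P)
    (hE : ∀ {n : SimplexCategory} (σ : (nerve P).obj (op n)), Continuous
      fun z : stdSimplex ℝ (Fin (n.len + 1)) × unitInterval => (E z.2).toHomeo σ z.1)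
    (X : StratSSet P) :
    Continuous fun z : SSet.toTop.obj X.left × unitInterval => (E z.2).realize X z.1 := by
  obtain ⟨G, hG⟩ := exists_continuousMap_simplexPoint (X := X.left)
    (T := C(unitInterval, SSet.toTop.obj X.left))
    (fun n τ t => ⟨fun r => simplexPoint τ ((E r).toHomeo (flag X τ) t),
      (continuous_simplexPoint τ).comp ((hE (flag X τ)).comp (Continuous.prodMk_right t))⟩)
    (fun n τ => ContinuousMap.continuous_of_continuous_uncurry _
      ((continuous_simplexPoint τ).comp (hE (flag X τ))))
    (fun m n g τ t => by
      ext r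
      change simplexPoint (X.left.map g.op τ)
        ((E r).toHomeo (flag X (X.left.map g.op τ)) t) =
        simplexPoint τ ((E r).toHomeo (flag X τ) (stdSimplex.map g t))
      rw [simplexPoint_map, flag_map, (E r).map_toHomeo])
  have h (x : SSet.toTop.obj X.left) (r : unitInterval) : (E r).realize X x = G x r := by
    obtain ⟨n, τ, t, rfl⟩ := exists_simplexPoint x
    rw [hG, realize_simplexPoint]
    rfl
  simp_rw [h]
  exact ContinuousMap.continuous_uncurry_of_continuous G

lemma continuous_iso_hom_app (E : unitInterval → SimplexAut P)
    (hE : ∀ {n : SimplexCategory} (σ : (nerve P).obj (op n)), Continuous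
      fun z : stdSimplex ℝ (Fin (n.len + 1)) × unitInterval => (E z.2).toHomeo σ z.1)
    (X : StratSSet P) :
    Continuous fun z : ((sReal P).obj X).left × unitInterval =>
      ((E z.2).iso.hom.app X).left z.1 :=
  continuous_realize E hE X

end SimplexAut

end Gluing

/-! ### Shrinking the standard neighborhoods -/

section Shrinking

/-- The natural family `flagFlow φ` of self-homeomorphisms of the stratified simplices. -/
noncomputable def flowAut (φ : ControlFamily P) : SimplexAut P where
  -- Continuity of the inverse is automatic for a continuous bijection from a compact to a Hausdorff
  -- space.
  toHomeo {n} σ := Continuous.homeoOfEquivCompactToT2 (f := flagFlow φ σ)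
    (continuous_rescaleList σ (Z := stdSimplex ℝ (Fin (n.len + 1))) (φ := fun _ => φ)
      (fun p => (φ.toFun p).continuous.comp continuous_snd) _ continuous_id)
  map_toHomeo g σ t := map_flagFlow φ σ g t
  flagSup_toHomeo σ t := flagSup_congr σ (rescaleList_pos_iff φ σ t _)

lemma simplexPoint_mem_phiHood_iff (φ : ControlFamily P) (X : StratSSet P) (p : P)
    {n : SimplexCategory} (τ : X.left.obj (op n)) (t : stdSimplex ℝ (Fin (n.len + 1))) :
    simplexPoint τ t ∈ phiHood φ X p ↔ (flagCoord {q | ¬ q ≤ p} (flag X τ) t : ℝ) ≤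
      φ.toFun p (flagCoord {q | ¬ q < p} (flag X τ) t) * flagCoord {p} (flag X τ) t := by
  unfold phiHood
  rw [← sCoord_simplexPoint, ← sCoord_simplexPoint, ← sCoord_simplexPoint]
  exact Iff.rfl

lemma flowAut_liftsToMap (φ : ControlFamily P) (X : StratSSet P) :
    LiftsToMap (stdSystem X) (phiSystem φ X) ((flowAut φ).iso.hom.app X) := by
  rintro p _ ⟨x, hx, rfl⟩
  obtain ⟨n, τ, t, rfl⟩ := exists_simplexPoint (X := X.left) x
  have hx' := (simplexPoint_mem_phiHood_iff (.one P) X p τ t).1 hx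
  change (_ : ℝ) ≤ 1 * _ at hx'
  rw [one_mul] at hx'
  have h := (simplexPoint_mem_phiHood_iff φ X p τ _).2 (flagFlow_mem φ (flag X τ) t p hx')
  exact (SimplexAut.iso_hom_app_simplexPoint (flowAut φ) X τ t) ▸ h

lemma phiHood_subset_one (φ : ControlFamily P) (X : StratSSet P) (p : P) :
    phiHood φ X p ⊆ phiHood (.one P) X p := fun _ hx =>
  le_trans (Set.mem_ofPred.1 hx)
    (mul_le_mul_of_nonneg_right (φ.toFun p _).2.2 (sCoord X {p} _).2.1)

lemma flowAut_stdHomotopicToId (φ : ControlFamily P) :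
    StdHomotopicToId (flowAut φ).iso := by
  refine ⟨fun r => (flowAut (φ.interp r)).iso, ?_, ?_, fun X => ?_, fun r X p => ?_⟩
  · dsimp only
    rw [φ.interp_zero]
    exact SimplexAut.iso_eq_refl _ fun σ t => rescaleList_one σ t _
  · dsimp only
    rw [φ.interp_one]
  · refine SimplexAut.continuous_iso_hom_app (fun r => flowAut (φ.interp r)) (fun σ => ?_) X
    refine continuous_rescaleList σ (fun p => ?_) _ continuous_fst
    exact (φ.continuous_interp p).comp
      ((continuous_snd.comp continuous_fst).prodMk continuous_snd)
  -- Control functions are at most `1`, so the neighborhoods reached at each time lie inside the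
  -- standard ones.
  · exact (flowAut_liftsToMap (φ.interp r) X p).trans (phiHood_subset_one _ X p)

/-- A natural automorphism which maps `N(X)` to `N^φ(X)` for all `X` lifts to a natural
transformation of functors to spaces with strata-neighborhood systems. -/
lemma exists_lift_of_liftsToMap (φ ψ : ControlFamily P) (Φ : sReal P ⟶ sReal P)
    (h : ∀ X, LiftsToMap (phiSystem φ X) (phiSystem ψ X) (Φ.app X)) :
    ∃ τ : phiSystemFunctor φ ⟶ phiSystemFunctor ψ,
      Functor.whiskerRight τ (NbhdCat.forget P) = Φ :=
  ⟨{ app := fun X => ⟨Φ.app X, h X⟩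
     naturality := fun _ _ f => Subtype.ext (Φ.naturality f) }, rfl⟩

end Shrinking

/-! ### Standard neighborhoods inside a given strata-neighborhood system -/

section Subordinate

/-- The stratum-preserving map from a stratified simplex given by a simplex of `X`. -/
def simplexMap (X : StratSSet P) {n : ℕ} (τ : X.left _⦋n⦌) :
    flagSimplex (flag X τ) ⟶ X :=
  Over.homMk (SSet.yonedaEquiv.symm τ) (SSet.yonedaEquiv_symm_comp τ X.hom)

/-- By Yoneda the identity simplex of `Δ[n]` maps to `τ`. This lets the definition of a
`Δ_P`-neighborhood be read in barycentric coordinates. -/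
lemma simplexMap_simplexPoint (X : StratSSet P) {n : ℕ} (τ : X.left _⦋n⦌)
    (t : stdSimplex ℝ (Fin (n + 1))) :
    ((sReal P).map (simplexMap X τ)).left
      (simplexPoint (X := Δ[n]) (n := ⦋n⦌) (SSet.stdSimplex.objEquiv.symm (𝟙 ⦋n⦌)) t) =
      simplexPoint (n := ⦋n⦌) τ t := by
  refine (toTop_map_simplexPoint (SSet.yonedaEquiv.symm τ) _ t).trans ?_
  have h : (SSet.yonedaEquiv.symm τ).app (op ⦋n⦌) (SSet.stdSimplex.objEquiv.symm (𝟙 ⦋n⦌)) = τ :=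
    SSet.yonedaEquiv.apply_symm_apply τ
  rw [h]

/-- On the geometric simplices of `X`, a `Δ_P`-neighborhood contains an open neighborhood. -/
lemma IsDeltaPNbhd.exists_isOpen {X : StratSSet P} {S U : Set ((sReal P).obj X).left}
    (h : IsDeltaPNbhd ((sReal P).obj X) S U) {n : ℕ} (τ : X.left _⦋n⦌) :
    ∃ O : Set (stdSimplex ℝ (Fin (n + 1))), IsOpen O ∧
      (∀ t, simplexPoint (n := ⦋n⦌) τ t ∈ S → t ∈ O) ∧
      ∀ t ∈ O, simplexPoint (n := ⦋n⦌) τ t ∈ U := by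
  obtain ⟨V, hV, hSV, hVU⟩ := mem_nhdsSet_iff_exists.1
    (h n (flag X τ) ((sReal P).map (simplexMap X τ)))
  refine ⟨_, hV.preimage (continuous_simplexPoint (X := Δ[n]) (n := ⦋n⦌)
    (SSet.stdSimplex.objEquiv.symm (𝟙 ⦋n⦌))), fun t ht => hSV ?_, fun t ht => ?_⟩
  · exact Set.mem_preimage.2 (simplexMap_simplexPoint X τ t ▸ ht)
  · exact simplexMap_simplexPoint X τ t ▸ hVU ht

lemma simplexPoint_mem_strataLE {X : StratSSet P} {p : P} {n : SimplexCategory}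
    (τ : X.left.obj (op n)) (t : stdSimplex ℝ (Fin (n.len + 1)))
    (h : (flagCoord {q | ¬ q ≤ p} (flag X τ) t : ℝ) = 0) :
    simplexPoint τ t ∈ strataLE ((sReal P).obj X) p := by
  have h1 := flagSup_le_of_flagCoord_eq_zero (flag X τ) t h
  have h2 := sReal_hom_simplexPoint X τ t
  change Topology.WithUpperSet.ofUpperSet (((sReal P).obj X).hom (simplexPoint τ t)) ≤ p
  exact h2 ▸ h1

lemma simplexPoint_mem_stratum {X : StratSSet P} {p : P} {n : SimplexCategory}
    (τ : X.left.obj (op n)) (t : stdSimplex ℝ (Fin (n.len + 1)))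
    (h : (flagCoord {q | ¬ q ≤ p} (flag X τ) t : ℝ) = 0)
    (hp : 0 < (flagCoord {p} (flag X τ) t : ℝ)) :
    simplexPoint τ t ∈ stratum ((sReal P).obj X) p := by
  have h1 := flagSup_eq_of_flagCoord (flag X τ) t h hp
  have h2 := sReal_hom_simplexPoint X τ t
  change Topology.WithUpperSet.ofUpperSet (((sReal P).obj X).hom (simplexPoint τ t)) = p
  exact h2 ▸ h1

/-- A function on `[0,1]` which is positive for `s > 0` and bounded by `y / 2` at `x`, for all
`(x, y)` in a compact subset of the plane which does not meet the positive half-axis. -/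
lemma exists_control_of_isCompact {D : Set (ℝ × ℝ)} (hD : IsCompact D)
    (h0 : ∀ s > 0, (s, (0 : ℝ)) ∉ D) :
    ∃ f : C(unitInterval, unitInterval), (∀ s, 0 < s → 0 < f s) ∧
      ∀ (s : unitInterval) (y : ℝ), 0 ≤ y → ((s : ℝ), y) ∈ D → (f s : ℝ) ≤ y / 2 := by
  -- The extra point `(0, 1)` keeps the set nonempty (`Metric.infDist` to the empty set is `0`) and
  -- bounds the distance from each `(s, 0)` by `1` in the max metric. It is off the positive
  -- half-axis.
  have hc : IsClosed (insert ((0 : ℝ), (1 : ℝ)) D) := (hD.insert _).isClosed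
  have hd (s : unitInterval) :
      Metric.infDist ((s : ℝ), (0 : ℝ)) (insert ((0 : ℝ), (1 : ℝ)) D) ≤ 1 := by
    refine (Metric.infDist_le_dist_of_mem (Set.mem_insert _ _)).trans ?_
    rw [Prod.dist_eq, Real.dist_eq, Real.dist_eq]
    simp [s.2.2, abs_of_nonneg s.2.1]
  refine ⟨⟨fun s => ⟨Metric.infDist ((s : ℝ), (0 : ℝ)) (insert ((0 : ℝ), (1 : ℝ)) D) / 2,
    div_nonneg Metric.infDist_nonneg zero_le_two, by have := hd s; linarith⟩, ?_⟩,
    fun s hs => ?_, fun s y hy hsy => ?_⟩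
  · refine Continuous.subtype_mk (Continuous.div_const ?_ _) _
    exact (Metric.continuous_infDist_pt _).comp (continuous_subtype_val.prodMk continuous_const)
  · have hs' : (0 : ℝ) < s := hs
    refine (half_pos ((hc.notMem_iff_infDist_pos (Set.insert_nonempty _ _)).1 ?_) :
      (0 : ℝ) < _ / 2)
    rw [Set.mem_insert_iff]
    rintro (h | h)
    · exact zero_ne_one (congrArg Prod.snd h)
    · exact h0 _ hs' h
  · change Metric.infDist ((s : ℝ), (0 : ℝ)) _ / 2 ≤ y / 2
    have h := Metric.infDist_le_dist_of_mem (x := ((s : ℝ), (0 : ℝ)))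
      (Set.mem_insert_of_mem ((0 : ℝ), (1 : ℝ)) hsy)
    rw [Prod.dist_eq, dist_self, Real.dist_eq, zero_sub, abs_neg, abs_of_nonneg hy,
      max_eq_right hy] at h
    linarith

/-- Every strata-neighborhood system on the realization of a finite stratified simplicial set
contains a `φ`-standard system. -/
lemma exists_phiHood_subset (X : StratSSet P) (hX : SSet.Finite X.left)
    (U : StrataNbhdSystem ((sReal P).obj X)) :
    ∃ φ : ControlFamily P, ∀ p, phiHood φ X p ⊆ U.nbhd p := by
  have key (p : P) : ∃ f : C(unitInterval, unitInterval), (∀ s, 0 < s → 0 < f s) ∧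
      ∀ x : ((sReal P).obj X).left, (sCoord X {q | ¬ q ≤ p} x : ℝ) ≤
        f (sCoord X {q | ¬ q < p} x) * sCoord X {p} x → x ∈ U.nbhd p := by
    choose O hO hSO hOU using fun k : X.left.N =>
      (U.isDeltaPNbhd p).exists_isOpen k.simplex
    let c (k : X.left.N) (t : stdSimplex ℝ (Fin (k.dim + 1))) : ℝ × ℝ :=
      ((flagCoord {q | ¬ q < p} (flag X (n := ⦋k.dim⦌) k.simplex) t : ℝ),
        (flagCoord {q | ¬ q ≤ p} (flag X (n := ⦋k.dim⦌) k.simplex) t : ℝ))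
    have hc (k : X.left.N) : Continuous (c k) :=
      (continuous_subtype_val.comp
        (continuous_flagCoord (flag X (n := ⦋k.dim⦌) k.simplex) _)).prodMk
        (continuous_subtype_val.comp (continuous_flagCoord (flag X (n := ⦋k.dim⦌) k.simplex) _))
    -- Finiteness of `X` enters here: the union runs over finitely many nondegenerate simplices.
    have hD : IsCompact (⋃ k, c k '' (O k)ᶜ) :=
      isCompact_iUnion fun k => (hO k).isClosed_compl.isCompact.image (hc k)
    obtain ⟨f, hf, hfD⟩ := exists_control_of_isCompact hD (by
      -- A point with `s_{≰p} = 0` and `s_{≮p} = s > 0` has `s_p = s > 0`, so it lies in the stratum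
      -- `p` and hence in `O k`.
      intro s hs h
      obtain ⟨k, t, ht, hst⟩ := Set.mem_iUnion.1 h
      have h1 : (flagCoord {q | ¬ q < p} (flag X (n := ⦋k.dim⦌) k.simplex) t : ℝ) = s :=
        congrArg Prod.fst hst
      have h2 : (flagCoord {q | ¬ q ≤ p} (flag X (n := ⦋k.dim⦌) k.simplex) t : ℝ) = 0 :=
        congrArg Prod.snd hst
      rw [flagCoord_not_lt, h2, add_zero] at h1
      exact ht (hSO k t (simplexPoint_mem_stratum _ _ h2 (h1 ▸ hs))))
    refine ⟨f, hf, fun x hx => ?_⟩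
    obtain ⟨m, σ, t, rfl⟩ := exists_simplexPoint (X := X.left) x
    -- Every point can be written on a nondegenerate simplex, where the sets `O k` are available.
    obtain ⟨l, g, -, y, hy⟩ := X.left.exists_nonDegenerate (n := m.len) σ
    have hσ : simplexPoint σ t = simplexPoint (n := ⦋l⦌) y.1 (stdSimplex.map g t) := by
      rw [← simplexPoint_map, ← hy]
    rw [hσ] at hx ⊢
    generalize stdSimplex.map g t = t' at hx ⊢
    let k : X.left.N := SSet.N.mk y.1 y.2
    rw [sCoord_simplexPoint, sCoord_simplexPoint, sCoord_simplexPoint] at hx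
    by_cases ht : t' ∈ O k
    · exact hOU k t' ht
    have hy2 := hfD (flagCoord {q | ¬ q < p} (flag X (n := ⦋l⦌) y.1) t')
      (flagCoord {q | ¬ q ≤ p} (flag X (n := ⦋l⦌) y.1) t') (flagCoord _ _ _).2.1
      (Set.mem_iUnion.2 ⟨k, t', ht, rfl⟩)
    -- Outside `O k` the bounds give `s_{≰p} ≤ (s_{≰p} / 2) s_p ≤ s_{≰p} / 2`, thanks to the factor
    -- `1/2`. So `s_{≰p} = 0`, and the point lies in `T_{≤p}`, which is contained in `U(p)`.
    refine U.strataLE_subset p (simplexPoint_mem_strataLE _ _ (le_antisymm ?_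
      (flagCoord _ _ _).2.1))
    have h1 := mul_le_mul hy2 (flagCoord {p} (flag X (n := ⦋l⦌) y.1) t').2.2
      (flagCoord {p} (flag X (n := ⦋l⦌) y.1) t').2.1
      (div_nonneg (flagCoord {q | ¬ q ≤ p} (flag X (n := ⦋l⦌) y.1) t').2.1 zero_le_two)
    linarith [hx.trans h1]
  choose f hf hfU using key
  exact ⟨⟨f, hf⟩, fun p x hx => hfU p x hx⟩

/-- The preimage of a strata-neighborhood system under a stratum-preserving map. -/
def StrataNbhdSystem.comap {T T' : StratTop P} (U : StrataNbhdSystem T') (f : T ⟶ T') :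
    StrataNbhdSystem T where
  nbhd p := f.left ⁻¹' U.nbhd p
  isDeltaPNbhd p n σ g := by
    have h : f.left ⁻¹' stratum T' p = stratum T p := by
      ext x
      have hx : T'.hom (f.left x) = T.hom x := congrArg (fun F => F x) (Over.w f)
      change Topology.WithUpperSet.ofUpperSet (T'.hom (f.left x)) = p ↔ _
      rw [hx]
      rfl
    rw [← h]
    exact U.isDeltaPNbhd p n σ (g ≫ f)
  strataLE_subset p x hx := by
    have h : T'.hom (f.left x) = T.hom x := congrArg (fun F => F x) (Over.w f)
    refine U.strataLE_subset p ?_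
    change Topology.WithUpperSet.ofUpperSet (T'.hom (f.left x)) ≤ p
    rw [h]
    exact hx

end Subordinate

end StratNbhd

theorem mainTheorem5 (P : Type u) [PartialOrder P] :
    (∀ φ : StratNbhd.ControlFamily P,
      ∃ Φ : StratNbhd.sReal P ≅ StratNbhd.sReal P,
        (∀ X : StratNbhd.StratSSet P, StratNbhd.LiftsToMap
          (StratNbhd.stdSystem X) (StratNbhd.phiSystem φ X) (Φ.hom.app X)) ∧
        (∃ τ : StratNbhd.phiSystemFunctor (StratNbhd.ControlFamily.one P) ⟶
            StratNbhd.phiSystemFunctor φ,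
          Functor.whiskerRight τ (StratNbhd.NbhdCat.forget P) = Φ.hom) ∧
        StratNbhd.StdHomotopicToId Φ) ∧
    (∀ X : StratNbhd.StratSSet P, SSet.Finite X.left →
      ∀ U : StratNbhd.StrataNbhdSystem ((StratNbhd.sReal P).obj X),
        ∃ φ : StratNbhd.ControlFamily P,
          (∀ p : P, StratNbhd.phiHood φ X p ⊆ U.nbhd p) ∧
          StratNbhd.LiftsToMap (StratNbhd.phiSystem φ X) U (𝟙 _)) ∧
    (∀ X : StratNbhd.StratSSet P, SSet.Finite X.left →
      ∀ (Y : StratNbhd.StratTop P) (U : StratNbhd.StrataNbhdSystem Y)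
        (f : (StratNbhd.sReal P).obj X ⟶ Y),
        ∃ Φ : StratNbhd.sReal P ≅ StratNbhd.sReal P,
          StratNbhd.StdHomotopicToId Φ ∧
          StratNbhd.LiftsToMap (StratNbhd.stdSystem X) U (Φ.hom.app X ≫ f)) := by
  refine ⟨fun φ => ⟨(StratNbhd.flowAut φ).iso, StratNbhd.flowAut_liftsToMap φ,
    StratNbhd.exists_lift_of_liftsToMap _ _ _ (StratNbhd.flowAut_liftsToMap φ),
    StratNbhd.flowAut_stdHomotopicToId φ⟩, fun X hX U => ?_, fun X hX Y U f => ?_⟩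
  · obtain ⟨φ, hφ⟩ := StratNbhd.exists_phiHood_subset X hX U
    refine ⟨φ, hφ, ?_⟩
    rintro p _ ⟨x, hx, rfl⟩
    exact hφ p hx
  -- A control family subordinate to the pullback of `U` is chosen, and its flow moves `N(X)` into
  -- that pullback.
  · obtain ⟨φ, hφ⟩ := StratNbhd.exists_phiHood_subset X hX (U.comap f)
    refine ⟨(StratNbhd.flowAut φ).iso, StratNbhd.flowAut_stdHomotopicToId φ, ?_⟩
    rintro p _ ⟨x, hx, rfl⟩
    exact hφ p (StratNbhd.flowAut_liftsToMap φ X p ⟨x, hx, rfl⟩)
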